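/- A polytope is the convex hull of finitely many points of some $\mathbb R^q$, an $n$-polytope is one whose affine hull has dimension $n$, and $f_P=(1,f_0,\dots,f_{n-1},1)$ denotes the $f$-vector of an $n$-polytope $P$, where $f_d$ is the number of $d$-dimensional faces (the outer entries count the empty face and $P$ itself). A simplex $\Sigma$ spanned by $m+1$ (affinely independent) vertices of an $n$-polytope $P$ is called a special $m$-simplex of $P$ if every facet of $P$ contains exactly $m$ of these vertices. Its basis polytope $Q$ is the image of $P$ under the linear projection whose kernel is the linear subspace parallel to the affine hull of $\Sigma$. Let $\mathcal A$ be the affine hull of the union of all faces of $P$ that contain no vertex of $\Sigma$. $P$ is called meek (with respect to $\Sigma$) if $\dim Q=\dim\mathcal A$. Let $\mathcal S_{(n,m)}$ be the class of $n$-polytopes having a special $m$-simplex, and $\mathcal M_{(n,m)}$ the class of those having a special $m$-simplex with respect to which they are meek. A bipyramid over a polygon (2-polytope) $B$ is a polytope $\operatorname{conv}(B\cup\{v,w\})$ where $v,w$ lie outside the affine hull of $B$ and the open segment between $v$ and $w$ meets the relative interior of $B$. Then: 1. $\mathcal S_{(2,1)}=\mathcal M_{(2,1)}=\{P : f_P=(1,4,4,1)\}$,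 i.e. exactly the convex quadrilaterals. 2. $\mathcal S_{(3,2)}=\mathcal M_{(3,2)}=\{P : f_P=(1,5,9,6,1)\text{ or }f_P=(1,5,8,5,1)\}$. 3. $\mathcal M_{(3,1)}$ consists exactly of the bipyramids over polygons. The bipyramid over a $k$-gon ($k\ge 3$) has $f$-vector $(1,k+2,3k,2k,1)$, and for every $k\ge 3$ (and $q\geq 3$) this $f$-vector is attained by a member of $\mathcal M_{(3,1)}$ in $\mathbb R^q$. Hence the $f$-vectors of members of $\mathcal M_{(3,1)}$ are exactly the vectors $(1,k+2,3k,2k,1)$, $k\ge 3$. -/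

import Mathlib

/-- The dimension of (the affine hull of) a set, with `dim ∅ = -1`. -/
noncomputable def affDim {V : Type*} [AddCommGroup V] [Module ℝ V] (S : Set V) : ℤ :=
  open Classical in
  if S.Nonempty then (Module.finrank ℝ (vectorSpan ℝ S) : ℤ) else -1

/-- A polytope is the convex hull of finitely many points. -/
def IsPolytope {V : Type*} [AddCommGroup V] [Module ℝ V] (P : Set V) : Prop :=
  ∃ s : Finset V, P = convexHull ℝ (s : Set V)

section

variable {V : Type*} [NormedAddCommGroup V] [NormedSpace ℝ V]

/-- The face complex of `P`: the intersections of `P` with its supporting hyperplanes, together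
with `∅` and `P` itself (which is cut out by the zero functional). -/
def faceComplex (P : Set V) : Set (Set V) := {F | IsExposed ℝ P F}

/-- The facets of `P`: the faces of codimension one. -/
def facets (P : Set V) : Set (Set V) := {F | F ∈ faceComplex P ∧ affDim F = affDim P - 1}

/-- The vertex set of `P`. -/
def vertexSet (P : Set V) : Set V := {v | {v} ∈ faceComplex P}

/-- The `f`-vector `(f_{-1}, f_0, …, f_{n-1}, f_n)` of an `n`-polytope `P`, where `f_d` is the
number of `d`-dimensional faces; thus `f_{-1} = f_n = 1`. -/
noncomputable def fVector (P : Set V) : List ℕ :=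
  (List.range (affDim P + 2).toNat).map
    (fun i => {F | F ∈ faceComplex P ∧ affDim F = (i : ℤ) - 1}.ncard)

/-- The `m`-simplex `s` is special in `P`: it is spanned by `m + 1` vertices of `P`, and every
facet of `P` contains exactly `m` of them. -/
def IsSpecialSimplex (P : Set V) {m : ℕ} (s : Affine.Simplex ℝ V m) : Prop :=
  (∀ i, s.points i ∈ vertexSet P) ∧ ∀ F ∈ facets P, {i | s.points i ∈ F}.ncard = m

/-- The subcomplex of all faces of `P` that contain no vertex of the simplex `s`. -/
def avoidingComplex (P : Set V) {m : ℕ} (s : Affine.Simplex ℝ V m) : Set (Set V) :=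
  {F | F ∈ faceComplex P ∧ ∀ i, s.points i ∉ F}

/-- The basis polytope: the image of `P` under the linear projection whose kernel is the linear
subspace parallel to the affine hull of the simplex. -/
def basisPolytope (P : Set V) {m : ℕ} (s : Affine.Simplex ℝ V m) :
    Set (V ⧸ vectorSpan ℝ (Set.range s.points)) :=
  (vectorSpan ℝ (Set.range s.points)).mkQ '' P

/-- `P` is meek with respect to `s`: the basis polytope has the same dimension as the affine hull
of the complex of all faces of `P` that avoid the vertices of `s`. -/
def IsMeek (P : Set V) {m : ℕ} (s : Affine.Simplex ℝ V m) : Prop :=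
  affDim (basisPolytope P s) =
    affDim (affineSpan ℝ (⋃₀ avoidingComplex P s) : Set V)

/-- The `n`-polytopes in `V` with some special `m`-simplex. -/
def specialPolytopes (V : Type*) [NormedAddCommGroup V] [NormedSpace ℝ V] (n m : ℕ) :
    Set (Set V) :=
  {P | IsPolytope P ∧ affDim P = n ∧ ∃ s : Affine.Simplex ℝ V m, IsSpecialSimplex P s}

/-- The meek `n`-polytopes in `V` with some special `m`-simplex. -/
def meekPolytopes (V : Type*) [NormedAddCommGroup V] [NormedSpace ℝ V] (n m : ℕ) :
    Set (Set V) :=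
  {P | IsPolytope P ∧ affDim P = n ∧
    ∃ s : Affine.Simplex ℝ V m, IsSpecialSimplex P s ∧ IsMeek P s}

/-- `P` is a bipyramid with base `Q`: the convex hull of `Q` and two apices `v`, `w` outside the
affine hull of `Q` such that an interior point of the segment from `v` to `w` lies in the relative
interior of `Q`. -/
def IsBipyramidOver (P Q : Set V) : Prop :=
  ∃ v w : V, v ∉ affineSpan ℝ Q ∧ w ∉ affineSpan ℝ Q ∧
    (openSegment ℝ v w ∩ intrinsicInterior ℝ Q).Nonempty ∧
    P = convexHull ℝ (Q ∪ {v, w})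

end

/-! Parts 1 and 2 concern a special `m`-simplex in an `(m + 1)`-polytope `P`. Its affine hull is a
hyperplane of the affine hull of `P`, and `P` has vertices `z`, `w` of extreme height on the two
sides: a simplex lying in a proper face would have all `m + 1` vertices in one facet. The part of
`P` on the side of `z` is the pyramid over the simplex with apex `z`
(`IsSpecialSimplex.exists_coeffs`): a negative barycentric coordinate at a simplex vertex forces
every facet through `z` to contain that vertex, so the segment from it to `z` could be prolonged
inside `P` to a greater height. Hence `P` is the hull of the simplex, `z` and `w`, and its only
affine dependency has positive support `{z, w}` and at least two negative coefficients.

By Gale duality (`IsAffineCircuit.isCircuitFace_iff`) the faces of a configuration with a single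
dependency are read off from the signs of its coefficients, so f-vectors and specialness become
finite checks. Conversely, `m + 3` vertices in dimension `m + 1` carry a single dependency; convex
position forces both signs at least twice, and with at most five vertices one sign occurs exactly
twice, which gives the same normal form.

For part 3, let `W` be the set of vertices off the special edge of a meek 3-polytope. Meekness says
that `W` spans a plane. Specialness puts the ends of the edge strictly on opposite sides of this
plane and makes the edge cross it in the relative interior of `conv W`; otherwise some nonconstant
supporting functional would be maximal on the whole edge. Conversely, the proper faces of a
bipyramid are the proper faces of the base and the cones over them from either apex
(`AreApices.exists_face`), which yields specialness, meekness and the f-vector, since a polygon has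
as many edges as vertices. Polygons inscribed in a parabola realize every `k`.

Both halves use facets: a supporting hyperplane can be rotated until it supports a facet
(`IsPolytope.exists_facet_of_level`). -/

set_option linter.unusedSectionVars false

/-! ### Dimension of affine hulls -/

section AffDim

variable {V : Type*} [AddCommGroup V] [Module ℝ V]

theorem affDim_of_nonempty {S : Set V} (hS : S.Nonempty) :
    affDim S = Module.finrank ℝ (vectorSpan ℝ S) := by
  simp [affDim, hS]

theorem affDim_empty : affDim (∅ : Set V) = -1 := by
  simp [affDim]

theorem affDim_nonneg_iff {S : Set V} : 0 ≤ affDim S ↔ S.Nonempty := by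
  by_cases hS : S.Nonempty
  · simp [affDim_of_nonempty hS, hS]
  · simp [affDim, hS]

theorem neg_one_le_affDim (S : Set V) : -1 ≤ affDim S := by
  by_cases hS : S.Nonempty
  · rw [affDim_of_nonempty hS]; omega
  · simp [affDim, hS]

theorem nonempty_of_affDim {S : Set V} {n : ℕ} (h : affDim S = n) : S.Nonempty :=
  affDim_nonneg_iff.1 (by omega)

theorem affDim_singleton (x : V) : affDim ({x} : Set V) = 0 := by
  rw [affDim_of_nonempty (Set.singleton_nonempty x)]; simp

theorem affDim_congr {S T : Set V} (h : affineSpan ℝ S = affineSpan ℝ T) :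
    affDim S = affDim T := by
  have hne : S.Nonempty ↔ T.Nonempty := by
    rw [← affineSpan_nonempty ℝ, h, affineSpan_nonempty]
  by_cases hS : S.Nonempty
  · rw [affDim_of_nonempty hS, affDim_of_nonempty (hne.1 hS), ← direction_affineSpan, h,
      direction_affineSpan]
  · simp [affDim, hS, mt hne.2 hS]

theorem affDim_convexHull (S : Set V) : affDim (convexHull ℝ S) = affDim S :=
  affDim_congr (affineSpan_convexHull S)

theorem affDim_affineSpan (S : Set V) : affDim (affineSpan ℝ S : Set V) = affDim S :=
  affDim_congr (by simp)

theorem affDim_mono [FiniteDimensional ℝ V] {S T : Set V} (h : S ⊆ T) : affDim S ≤ affDim T := by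
  by_cases hS : S.Nonempty
  · rw [affDim_of_nonempty hS, affDim_of_nonempty (hS.mono h)]
    exact_mod_cast Submodule.finrank_mono (vectorSpan_mono ℝ h)
  · rw [Set.not_nonempty_iff_eq_empty.1 hS, affDim_empty]
    exact neg_one_le_affDim T

theorem vectorSpan_eq_of_affDim_le [FiniteDimensional ℝ V] {S T : Set V} (h : S ⊆ T)
    (hS : S.Nonempty) (hd : affDim T ≤ affDim S) : vectorSpan ℝ S = vectorSpan ℝ T := by
  rw [affDim_of_nonempty hS, affDim_of_nonempty (hS.mono h)] at hd
  exact Submodule.eq_of_le_of_finrank_le (vectorSpan_mono ℝ h) (by exact_mod_cast hd)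

theorem affineSpan_eq_of_affDim_le [FiniteDimensional ℝ V] {S T : Set V} (h : S ⊆ T)
    (hS : S.Nonempty) (hd : affDim T ≤ affDim S) : affineSpan ℝ S = affineSpan ℝ T := by
  obtain ⟨x, hx⟩ := hS
  refine AffineSubspace.ext_of_direction_eq ?_
    ⟨x, subset_affineSpan ℝ S hx, subset_affineSpan ℝ T (h hx)⟩
  rw [direction_affineSpan, direction_affineSpan, vectorSpan_eq_of_affDim_le h ⟨x, hx⟩ hd]

theorem affDim_insert_of_mem {S : Set V} {x : V} (hx : x ∈ affineSpan ℝ S) :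
    affDim (insert x S) = affDim S :=
  affDim_congr (affineSpan_insert_eq_affineSpan ℝ hx)

theorem vectorSpan_insert_eq_sup {S : Set V} {x y : V} (hy : y ∈ S) :
    vectorSpan ℝ (insert x S) = vectorSpan ℝ S ⊔ Submodule.span ℝ {x - y} := by
  rw [vectorSpan_eq_span_vsub_set_right ℝ (Set.mem_insert_of_mem x hy),
    vectorSpan_eq_span_vsub_set_right ℝ hy, ← Submodule.span_union, Set.image_insert_eq,
    Set.union_comm]
  rfl

theorem affDim_insert_le [FiniteDimensional ℝ V] (S : Set V) (x : V) :
    affDim (insert x S) ≤ affDim S + 1 := by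
  by_cases hS : S.Nonempty
  · obtain ⟨y, hy⟩ := hS
    rw [affDim_of_nonempty (Set.insert_nonempty x S), affDim_of_nonempty ⟨y, hy⟩,
      vectorSpan_insert_eq_sup hy]
    have h1 := Submodule.finrank_add_le_finrank_add_finrank (vectorSpan ℝ S)
      (Submodule.span ℝ {x - y})
    have h2 : Module.finrank ℝ (Submodule.span ℝ {x - y}) ≤ 1 := by
      simpa using finrank_span_le_card (R := ℝ) ({x - y} : Set V)
    omega
  · rw [Set.not_nonempty_iff_eq_empty.1 hS, affDim_empty]
    simp [affDim_singleton]

theorem affDim_insert_of_notMem [FiniteDimensional ℝ V] {S : Set V} {x : V}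
    (hx : x ∉ affineSpan ℝ S) : affDim (insert x S) = affDim S + 1 := by
  refine le_antisymm (affDim_insert_le S x) ?_
  by_cases hS : S.Nonempty
  · by_contra! h
    apply hx
    rw [affineSpan_eq_of_affDim_le (Set.subset_insert x S) hS (by omega)]
    exact subset_affineSpan ℝ _ (Set.mem_insert x S)
  · rw [Set.not_nonempty_iff_eq_empty.1 hS, affDim_empty]
    simp [affDim_singleton]

theorem affDim_pair [FiniteDimensional ℝ V] {x y : V} (h : x ≠ y) :
    affDim ({x, y} : Set V) = 1 := by
  rw [affDim_insert_of_notMem (by simpa using h), affDim_singleton]; rfl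

theorem affDim_finset_le [FiniteDimensional ℝ V] (s : Finset V) :
    affDim (s : Set V) ≤ s.card - 1 := by
  classical
  induction s using Finset.induction_on with
  | empty => simp [affDim_empty]
  | insert a s ha ih =>
    rw [Finset.coe_insert, Finset.card_insert_of_notMem ha]
    have := affDim_insert_le (s : Set V) a
    push_cast
    omega

end AffDim

/-! ### Supporting functionals, faces and vertices -/

section Functional

variable {V : Type*} [NormedAddCommGroup V] [NormedSpace ℝ V]

theorem map_eq_zero_of_mem_vectorSpan {S : Set V} {l : StrongDual ℝ V} {M : ℝ}
    (h : ∀ x ∈ S, l x = M) {d : V} (hd : d ∈ vectorSpan ℝ S) : l d = 0 := by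
  have : vectorSpan ℝ S ≤ LinearMap.ker (l : V →ₗ[ℝ] ℝ) := by
    refine Submodule.span_le.2 ?_
    rintro _ ⟨x, hx, y, hy, rfl⟩
    simp [h x hx, h y hy]
  exact this hd

theorem map_eq_of_mem_affineSpan {S : Set V} {l : StrongDual ℝ V} {M : ℝ}
    (h : ∀ x ∈ S, l x = M) {x : V} (hx : x ∈ affineSpan ℝ S) : l x = M := by
  obtain ⟨y, hy⟩ : S.Nonempty := (affineSpan_nonempty (k := ℝ)).1 ⟨x, hx⟩
  have := map_eq_zero_of_mem_vectorSpan h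
    (by simpa [direction_affineSpan] using
      AffineSubspace.vsub_mem_direction hx (subset_affineSpan ℝ S hy))
  rw [map_sub, h y hy] at this
  linarith

theorem sub_mem_vectorSpan {S : Set V} {x y : V} (hx : x ∈ affineSpan ℝ S)
    (hy : y ∈ affineSpan ℝ S) : x - y ∈ vectorSpan ℝ S := by
  simpa [direction_affineSpan] using AffineSubspace.vsub_mem_direction hx hy

theorem add_mem_affineSpan {S : Set V} {x d : V} (hx : x ∈ affineSpan ℝ S)
    (hd : d ∈ vectorSpan ℝ S) : x + d ∈ affineSpan ℝ S := by
  rw [← direction_affineSpan] at hd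
  simpa [add_comm] using AffineSubspace.vadd_mem_of_mem_direction hd hx

theorem le_of_mem_convexHull {S : Set V} {l : StrongDual ℝ V} {M : ℝ}
    (h : ∀ x ∈ S, l x ≤ M) {x : V} (hx : x ∈ convexHull ℝ S) : l x ≤ M :=
  convexHull_min (t := {x | l x ≤ M}) h (convex_halfSpace_le l.toLinearMap.isLinear M) hx

/-- A supporting hyperplane of a convex hull cuts out the convex hull of the points on it. -/
theorem convexHull_inter_level {S : Set V} {l : StrongDual ℝ V} {M : ℝ}
    (h : ∀ x ∈ S, l x ≤ M) :
    {x | x ∈ convexHull ℝ S ∧ l x = M} = convexHull ℝ {x | x ∈ S ∧ l x = M} := by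
  apply Set.Subset.antisymm
  · rintro x ⟨hx, hxM⟩
    -- The conditional membership is preserved by convex combinations: a proper combination reaches
    -- the value `M` only if both ends do.
    have hconv : Convex ℝ {x : V | l x ≤ M ∧ (l x = M → x ∈ convexHull ℝ {x | x ∈ S ∧ l x = M})} := by
      rintro x ⟨hx, hx'⟩ y ⟨hy, hy'⟩ a b ha hb hab
      rcases ha.eq_or_lt with rfl | ha
      · obtain rfl : b = 1 := by linarith
        simpa using ⟨hy, hy'⟩
      rcases hb.eq_or_lt with rfl | hb
      · obtain rfl : a = 1 := by linarith
        simpa using ⟨hx, hx'⟩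
      have e : l (a • x + b • y) = a * l x + b * l y := by simp
      refine ⟨?_, fun heq => ?_⟩
      · rw [e]
        have h1 := mul_le_mul_of_nonneg_left hx ha.le
        have h2 := mul_le_mul_of_nonneg_left hy hb.le
        have h3 : a * M + b * M = M := by rw [← add_mul, hab, one_mul]
        linarith
      · rw [e] at heq
        have h3 : a * M + b * M = M := by rw [← add_mul, hab, one_mul]
        have h4 := mul_le_mul_of_nonneg_left hx ha.le
        have h5 := mul_le_mul_of_nonneg_left hy hb.le
        have h1 : l x = M := by
          by_contra hne
          have := mul_lt_mul_of_pos_left (lt_of_le_of_ne hx hne) ha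
          linarith
        have h2 : l y = M := by
          by_contra hne
          have := mul_lt_mul_of_pos_left (lt_of_le_of_ne hy hne) hb
          linarith
        exact convex_convexHull ℝ _ (hx' h1) (hy' h2) ha.le hb.le hab
    have hsub : S ⊆ {x : V | l x ≤ M ∧ (l x = M → x ∈ convexHull ℝ {x | x ∈ S ∧ l x = M})} :=
      fun x hx => ⟨h x hx, fun e => subset_convexHull ℝ {x | x ∈ S ∧ l x = M} ⟨hx, e⟩⟩
    exact (convexHull_min hsub hconv hx).2 hxM
  · intro x hx
    refine ⟨convexHull_mono (fun y hy => hy.1) hx, ?_⟩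
    refine convexHull_min (t := {x | l x = M}) (fun y hy => hy.2) ?_ hx
    exact convex_hyperplane l.toLinearMap.isLinear M

theorem exists_level_of_mem_faceComplex {P F : Set V} (hF : F ∈ faceComplex P)
    (hne : F.Nonempty) :
    ∃ (l : StrongDual ℝ V) (M : ℝ), (∀ x ∈ P, l x ≤ M) ∧ F = {x | x ∈ P ∧ l x = M} := by
  obtain ⟨l, rfl⟩ := hF hne
  obtain ⟨y, hy, hmax⟩ := hne
  refine ⟨l, l y, hmax, ?_⟩
  ext x
  exact ⟨fun hx => ⟨hx.1, le_antisymm (hmax x hx.1) (hx.2 y hy)⟩,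
    fun hx => ⟨hx.1, fun z hz => hx.2 ▸ hmax z hz⟩⟩

theorem level_mem_faceComplex {P : Set V} {l : StrongDual ℝ V} {M : ℝ}
    (h : ∀ x ∈ P, l x ≤ M) : {x | x ∈ P ∧ l x = M} ∈ faceComplex P := by
  rintro ⟨y, hy, hyM⟩
  refine ⟨l, ?_⟩
  ext x
  exact ⟨fun hx => ⟨hx.1, fun z hz => hx.2 ▸ h z hz⟩,
    fun hx => ⟨hx.1, le_antisymm (h x hx.1) (hyM ▸ hx.2 y hy)⟩⟩

theorem empty_mem_faceComplex (P : Set V) : ∅ ∈ faceComplex P := fun h => absurd h (by simp)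

theorem self_mem_faceComplex (P : Set V) : P ∈ faceComplex P := by
  have := level_mem_faceComplex (P := P) (l := 0) (M := 0) (by simp)
  simpa using this

theorem subset_of_mem_faceComplex {P F : Set V} (hF : F ∈ faceComplex P) : F ⊆ P := by
  intro x hx
  obtain ⟨l, M, -, rfl⟩ := exists_level_of_mem_faceComplex hF ⟨x, hx⟩
  exact hx.1

theorem exists_level_of_mem_vertexSet {P : Set V} {v : V} (hv : v ∈ vertexSet P) :
    v ∈ P ∧ ∃ l : StrongDual ℝ V, ∀ x ∈ P, x ≠ v → l x < l v := by
  obtain ⟨l, M, hl, h⟩ := exists_level_of_mem_faceComplex (F := {v}) hv ⟨v, rfl⟩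
  have hvP : v ∈ {x | x ∈ P ∧ l x = M} := h ▸ rfl
  refine ⟨hvP.1, l, fun x hx hne => hvP.2 ▸ lt_of_le_of_ne (hl x hx) fun e => hne ?_⟩
  have : x ∈ ({v} : Set V) := h ▸ ⟨hx, e⟩
  exact this

theorem vertexSet_subset (P : Set V) : vertexSet P ⊆ P := fun _ hv =>
  (exists_level_of_mem_vertexSet hv).1

theorem vertexSet_convexHull_subset (S : Set V) : vertexSet (convexHull ℝ S) ⊆ S := by
  intro v hv
  obtain ⟨l, M, hl, h⟩ := exists_level_of_mem_faceComplex (F := {v}) hv ⟨v, rfl⟩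
  rw [convexHull_inter_level fun x hx => hl x (subset_convexHull ℝ _ hx)] at h
  obtain ⟨y, hy⟩ : {x | x ∈ S ∧ l x = M}.Nonempty := by
    rw [← convexHull_nonempty_iff (𝕜 := ℝ), ← h]; exact ⟨v, rfl⟩
  have : y ∈ ({v} : Set V) := h ▸ subset_convexHull ℝ _ hy
  rw [Set.mem_singleton_iff] at this
  exact this ▸ hy.1

/-- A vertex is not an inner point of a segment inside the polytope. -/
theorem eq_of_mem_vertexSet_of_combo {P : Set V} {v x y : V} (hv : v ∈ vertexSet P) (hx : x ∈ P)
    (hy : y ∈ P) {a b : ℝ} (ha : 0 < a) (hb : 0 ≤ b) (hab : a + b = 1) (h : v = a • x + b • y) :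
    x = v := by
  obtain ⟨-, l, hl⟩ := exists_level_of_mem_vertexSet hv
  by_contra hne
  have h1 := hl x hx hne
  have h2 : l y ≤ l v := by
    by_cases e : y = v
    · rw [e]
    · exact (hl y hy e).le
  have h3 : l v = a * l x + b * l y := by
    conv_lhs => rw [h]
    simp
  have h4 := mul_lt_mul_of_pos_left h1 ha
  have h5 := mul_le_mul_of_nonneg_left h2 hb
  have h6 : a * l v + b * l v = l v := by rw [← add_mul, hab, one_mul]
  linarith

theorem notMem_convexHull_of_mem_vertexSet {P : Set V} {v : V} (hv : v ∈ vertexSet P)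
    {S : Set V} (hS : S ⊆ P) (hvS : v ∉ S) : v ∉ convexHull ℝ S := by
  intro h
  obtain ⟨-, l, hl⟩ := exists_level_of_mem_vertexSet hv
  have hS' : S ⊆ {x | l x < l v} := fun x hx => hl x (hS hx) fun e => hvS (e ▸ hx)
  have := convexHull_min hS' (convex_halfSpace_lt l.toLinearMap.isLinear (l v)) h
  exact lt_irrefl (l v) this

/-- Points lying in the hull of the others are discarded one at a time. When none is left, each
point is strictly separated from the hull of the rest, and the separating functional exposes it. -/
theorem Finset.exists_vertexSet_eq (s : Finset V) :
    ∃ t : Finset V, t ⊆ s ∧ convexHull ℝ (t : Set V) = convexHull ℝ (s : Set V) ∧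
      vertexSet (convexHull ℝ (s : Set V)) = t := by
  classical
  induction s using Finset.strongInduction with
  | H s ih =>
    by_cases h : ∃ x ∈ s, x ∈ convexHull ℝ ((s.erase x : Finset V) : Set V)
    · obtain ⟨x, hx, hxs⟩ := h
      obtain ⟨t, hts, ht, htv⟩ := ih _ (Finset.erase_ssubset hx)
      have e : convexHull ℝ ((s.erase x : Finset V) : Set V) = convexHull ℝ (s : Set V) := by
        refine (convexHull_mono (by simp)).antisymm (convexHull_min ?_ (convex_convexHull ℝ _))
        intro y hy
        by_cases hyx : y = x
        · exact hyx ▸ hxs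
        · exact subset_convexHull ℝ _ (by simpa [hyx] using hy)
      exact ⟨t, hts.trans (Finset.erase_subset _ _), ht.trans e, e ▸ htv⟩
    · push Not at h
      refine ⟨s, subset_rfl, rfl, (vertexSet_convexHull_subset _).antisymm ?_⟩
      intro x hx
      have hcl : IsClosed (convexHull ℝ ((s.erase x : Finset V) : Set V)) :=
        (Set.Finite.isCompact_convexHull (𝕜 := ℝ) (s.erase x).finite_toSet).isClosed
      obtain ⟨f, u, hf, hu⟩ := geometric_hahn_banach_closed_point (convex_convexHull ℝ _) hcl
        (h x hx)
      have hval : ∀ y ∈ (s : Set V), f y ≤ f x := fun y hy => by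
        by_cases e : y = x
        · rw [e]
        · exact ((hf y (subset_convexHull ℝ _ (by simpa [e] using hy))).trans hu).le
      have := level_mem_faceComplex (P := convexHull ℝ (s : Set V)) (l := f) (M := f x)
        fun y hy => le_of_mem_convexHull hval hy
      rw [convexHull_inter_level hval] at this
      have e : {y | y ∈ (s : Set V) ∧ f y = f x} = {x} := by
        ext y
        constructor
        · rintro ⟨hy, hfy⟩
          by_contra e
          have := (hf y (subset_convexHull ℝ _
            (Finset.mem_coe.2 (Finset.mem_erase.2 ⟨e, hy⟩)))).trans hu
          exact this.ne hfy
        · rintro rfl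
          exact ⟨hx, rfl⟩
      rw [e, convexHull_singleton] at this
      exact this

variable {P : Set V}

theorem IsPolytope.finite_vertexSet (hP : IsPolytope P) : (vertexSet P).Finite := by
  obtain ⟨s, rfl⟩ := hP
  exact s.finite_toSet.subset (vertexSet_convexHull_subset _)

theorem IsPolytope.convexHull_vertexSet (hP : IsPolytope P) : convexHull ℝ (vertexSet P) = P := by
  obtain ⟨s, rfl⟩ := hP
  obtain ⟨t, -, ht, hv⟩ := s.exists_vertexSet_eq
  rw [hv, ht]

theorem IsPolytope.convex (hP : IsPolytope P) : Convex ℝ P := by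
  obtain ⟨s, rfl⟩ := hP
  exact convex_convexHull ℝ _

theorem IsPolytope.isCompact (hP : IsPolytope P) : IsCompact P := by
  obtain ⟨s, rfl⟩ := hP
  exact Set.Finite.isCompact_convexHull (𝕜 := ℝ) s.finite_toSet

theorem isPolytope_convexHull {S : Set V} (hS : S.Finite) : IsPolytope (convexHull ℝ S) :=
  ⟨hS.toFinset, by simp⟩

theorem IsPolytope.affineSpan_vertexSet (hP : IsPolytope P) :
    affineSpan ℝ (vertexSet P) = affineSpan ℝ P := by
  conv_rhs => rw [← hP.convexHull_vertexSet]
  rw [affineSpan_convexHull]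

theorem IsPolytope.affDim_vertexSet (hP : IsPolytope P) : affDim (vertexSet P) = affDim P :=
  affDim_congr hP.affineSpan_vertexSet

theorem IsPolytope.vertexSet_nonempty (hP : IsPolytope P) (hne : P.Nonempty) :
    (vertexSet P).Nonempty := by
  rw [← hP.convexHull_vertexSet] at hne
  exact convexHull_nonempty_iff.1 hne

theorem IsPolytope.level_eq_convexHull (hP : IsPolytope P) {l : StrongDual ℝ V} {M : ℝ}
    (hl : ∀ x ∈ P, l x ≤ M) :
    {x | x ∈ P ∧ l x = M} = convexHull ℝ {x | x ∈ vertexSet P ∧ l x = M} := by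
  rw [← convexHull_inter_level fun x hx => hl x (vertexSet_subset P hx), hP.convexHull_vertexSet]

theorem IsPolytope.face_eq_convexHull (hP : IsPolytope P) {F : Set V} (hF : F ∈ faceComplex P) :
    F = convexHull ℝ (F ∩ vertexSet P) := by
  by_cases hne : F.Nonempty
  · obtain ⟨l, M, hl, rfl⟩ := exists_level_of_mem_faceComplex hF hne
    conv_lhs => rw [hP.level_eq_convexHull hl]
    congr 1
    ext x
    exact ⟨fun h => ⟨⟨vertexSet_subset P h.1, h.2⟩, h.1⟩, fun h => ⟨h.2, h.1.2⟩⟩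
  · simp [Set.not_nonempty_iff_eq_empty.1 hne]

/-- A face is the hull of the vertices it contains, so it is determined by a subset of a finite set.
-/
theorem IsPolytope.finite_faceComplex (hP : IsPolytope P) : (faceComplex P).Finite := by
  refine Set.Finite.of_finite_image (f := fun F => F ∩ vertexSet P) ?_ ?_
  · exact hP.finite_vertexSet.finite_subsets.subset (by rintro _ ⟨F, -, rfl⟩; simp)
  · intro F hF G hG h
    rw [hP.face_eq_convexHull hF, hP.face_eq_convexHull hG]
    exact congrArg _ h

theorem IsPolytope.exists_max (hP : IsPolytope P) (hne : P.Nonempty) (l : StrongDual ℝ V) :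
    ∃ u ∈ vertexSet P, ∀ x ∈ P, l x ≤ l u := by
  obtain ⟨u, hu, hmax⟩ := Set.exists_max_image (vertexSet P) l hP.finite_vertexSet
    (hP.vertexSet_nonempty hne)
  refine ⟨u, hu, fun x hx => ?_⟩
  rw [← hP.convexHull_vertexSet] at hx
  exact le_of_mem_convexHull hmax hx

end Functional

/-! ### Facets, facet inequalities and relative interiors -/

section Facets

variable {V : Type*} [NormedAddCommGroup V] [NormedSpace ℝ V] [FiniteDimensional ℝ V] {P : Set V}

theorem exists_strongDual_of_notMem {p : Submodule ℝ V} {d : V} (hd : d ∉ p) (c : ℝ) :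
    ∃ k : StrongDual ℝ V, (∀ x ∈ p, k x = 0) ∧ k d = c := by
  obtain ⟨f, hf, hfd⟩ := LinearMap.exists_extend_of_notMem (0 : p →ₗ[ℝ] ℝ) hd c
  refine ⟨LinearMap.toContinuousLinearMap f, fun x hx => ?_, hfd⟩
  simpa using congr($hf ⟨x, hx⟩)

/-- There is an affine functional vanishing on `S` with a prescribed value at a point off the
affine hull of `S`. -/
theorem exists_strongDual_of_notMem_affineSpan {S : Set V} (hS : S.Nonempty) {x : V}
    (hx : x ∉ affineSpan ℝ S) (c : ℝ) :
    ∃ (k : StrongDual ℝ V) (m : ℝ), (∀ y ∈ affineSpan ℝ S, k y = m) ∧ k x = m + c := by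
  obtain ⟨y, hy⟩ := hS
  have hy' := subset_affineSpan ℝ S hy
  have hd : x - y ∉ vectorSpan ℝ S := fun h => hx (by simpa using add_mem_affineSpan hy' h)
  obtain ⟨k, hk, hkd⟩ := exists_strongDual_of_notMem hd c
  refine ⟨k, k y, fun z hz => ?_, ?_⟩
  · have := hk _ (sub_mem_vectorSpan hz hy')
    rw [map_sub] at this
    linarith
  · rw [map_sub] at hkd
    linarith

/-- A supporting hyperplane not containing a point `x` of the affine hull can be rotated about `x`
until it supports a facet, without changing its value at `x`. -/
theorem IsPolytope.exists_facet_of_level (hP : IsPolytope P) {l : StrongDual ℝ V} {M : ℝ}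
    (hl : ∀ y ∈ P, l y ≤ M) (hne : ∃ y ∈ P, l y = M) {x : V} (hx : x ∈ affineSpan ℝ P)
    (hlx : l x ≠ M) :
    ∃ (l' : StrongDual ℝ V) (M' : ℝ), (∀ y ∈ P, l' y ≤ M') ∧ (∀ y ∈ P, l y = M → l' y = M') ∧
      affDim {y | y ∈ P ∧ l' y = M'} = affDim P - 1 ∧ l' x - M' = l x - M := by
  classical
  obtain ⟨y₀, hy₀, hly₀⟩ := hne
  set U := hP.finite_vertexSet.toFinset with hU
  -- Induction on the number of vertices off the hyperplane; each rotation brings at least one more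
  -- onto it.
  induction hn : (U.filter fun u => l u ≠ M).card using Nat.strong_induction_on generalizing l M
    with | _ n ih =>
  set F := {y | y ∈ P ∧ l y = M} with hF
  have hFne : F.Nonempty := ⟨y₀, hy₀, hly₀⟩
  have hFP : F ⊆ P := fun y hy => hy.1
  have hlt : affDim F < affDim P := by
    by_contra! h
    rw [← affineSpan_eq_of_affDim_le hFP hFne h] at hx
    exact hlx (map_eq_of_mem_affineSpan (fun y hy => hy.2) hx)
  by_cases hd : affDim F = affDim P - 1
  · exact ⟨l, M, hl, fun y _ h => h, hd, rfl⟩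
  have hlt2 : affDim (insert x F) < affDim P := by
    have := affDim_insert_le F x
    omega
  have hins : affineSpan ℝ (insert x F) ≤ affineSpan ℝ P := by
    refine affineSpan_le.2 (Set.insert_subset hx (hFP.trans (subset_affineSpan ℝ P)))
  -- In codimension at least two, `F` and `x` together do not span. A functional `k` that is
  -- constant on their span can be added in any multiple without disturbing `F` or the offset at
  -- `x`.
  obtain ⟨u, hu, hunot⟩ : ∃ u ∈ vertexSet P, u ∉ affineSpan ℝ (insert x F) := by
    by_contra! h
    have := affineSpan_le.2 (show vertexSet P ⊆ affineSpan ℝ (insert x F) from h)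
    rw [hP.affineSpan_vertexSet] at this
    exact hlt2.ne (affDim_congr (hins.antisymm this))
  obtain ⟨k, m, hk, hku⟩ :=
    exists_strongDual_of_notMem_affineSpan (Set.insert_nonempty x F) hunot 1
  have hkF : ∀ y ∈ P, l y = M → k y = m := fun y hy h =>
    hk y (subset_affineSpan ℝ _ (Set.mem_insert_of_mem x ⟨hy, h⟩))
  have hkx : k x = m := hk x (subset_affineSpan ℝ _ (Set.mem_insert x F))
  set T := U.filter fun v => m < k v with hT
  have huT : u ∈ T := by simp [hT, hU, hu, hku]
  have hTlt : ∀ v ∈ T, l v < M := fun v hv => by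
    simp only [hT, hU, Finset.mem_filter, Set.Finite.mem_toFinset] at hv
    refine lt_of_le_of_ne (hl v (vertexSet_subset P hv.1)) fun e => ?_
    exact hv.2.ne' (hkF v (vertexSet_subset P hv.1) e)
  -- The least ratio is the largest multiple of `k` that keeps the inequality valid at all vertices;
  -- it becomes an equality at `w`.
  obtain ⟨w, hwT, hwmin⟩ := T.exists_min_image (fun v => (M - l v) / (k v - m)) ⟨u, huT⟩
  have hw : w ∈ vertexSet P ∧ m < k w := by
    simpa only [hT, hU, Finset.mem_filter, Set.Finite.mem_toFinset] using hwT
  set t := (M - l w) / (k w - m) with ht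
  have htpos : 0 < t := div_pos (sub_pos.2 (hTlt w hwT)) (sub_pos.2 hw.2)
  have hval : ∀ v ∈ vertexSet P, (l + t • k) v ≤ M + t * m := by
    intro v hv
    simp only [add_apply, smul_apply, smul_eq_mul]
    have h1 := hl v (vertexSet_subset P hv)
    by_cases hvT : m < k v
    · have h2 := hwmin v (by simp [hT, hU, hv, hvT])
      rw [le_div_iff₀ (sub_pos.2 hvT)] at h2
      linarith
    · have := mul_le_mul_of_nonneg_left (not_lt.1 hvT) htpos.le
      linarith
  have hval' : ∀ y ∈ P, (l + t • k) y ≤ M + t * m := fun y hy => by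
    rw [← hP.convexHull_vertexSet] at hy
    exact le_of_mem_convexHull hval hy
  have hface : ∀ y ∈ P, l y = M → (l + t • k) y = M + t * m := fun y hy h => by
    simp [h, hkF y hy h]
  have hweq : (l + t • k) w = M + t * m := by
    have : t * (k w - m) = M - l w := div_mul_cancel₀ _ (sub_pos.2 hw.2).ne'
    simp only [add_apply, smul_apply, smul_eq_mul]
    linarith
  have hxeq : (l + t • k) x - (M + t * m) = l x - M := by simp [hkx]
  obtain ⟨l', M', h1, h2, h3, h4⟩ := ih _ (by
    rw [← hn]
    refine Finset.card_lt_card (Finset.ssubset_iff_of_subset ?_ |>.2 ⟨w, ?_, ?_⟩)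
    · intro v hv
      simp only [hU, Finset.mem_filter, Set.Finite.mem_toFinset] at hv ⊢
      exact ⟨hv.1, fun e => hv.2 (hface v (vertexSet_subset P hv.1) e)⟩
    · simp only [hU, Finset.mem_filter, Set.Finite.mem_toFinset]
      exact ⟨hw.1, (hTlt w hwT).ne⟩
    · simp only [Finset.mem_filter, not_and, not_not]
      exact fun _ => hweq) hval' (by rw [← sub_ne_zero, hxeq]; exact sub_ne_zero.2 hlx)
      (hface y₀ hy₀ hly₀) rfl
  exact ⟨l', M', h1, fun y hy h => h2 y hy (hface y hy h), h3, h4.trans hxeq⟩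

/-- Every proper face is contained in a facet. -/
theorem IsPolytope.exists_facet_of_level_ne (hP : IsPolytope P) {l : StrongDual ℝ V} {M : ℝ}
    (hl : ∀ y ∈ P, l y ≤ M) (hne : ∃ y ∈ P, l y = M) {x : V} (hx : x ∈ P)
    (hlx : l x ≠ M) : ∃ F ∈ facets P, x ∉ F ∧ ∀ y ∈ P, l y = M → y ∈ F := by
  obtain ⟨l', M', h1, h2, h3, h4⟩ :=
    hP.exists_facet_of_level hl hne (subset_affineSpan ℝ P hx) hlx
  refine ⟨_, ⟨level_mem_faceComplex h1, h3⟩, fun h => ?_, fun y hy h => ⟨hy, h2 y hy h⟩⟩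
  rw [h.2, sub_self] at h4
  exact hlx (by linarith)

/-- Supporting functionals of the same facet are positive multiples of each other. -/
theorem facet_functional_unique {l l' : StrongDual ℝ V} {M M' : ℝ}
    (hl : ∀ y ∈ P, l y ≤ M) (hl' : ∀ y ∈ P, l' y ≤ M')
    (hne : ∃ y ∈ P, l y = M) (hsub : ∀ y ∈ P, l y = M → l' y = M')
    (hd : affDim {y | y ∈ P ∧ l y = M} = affDim P - 1) :
    ∃ c : ℝ, 0 ≤ c ∧ ∀ x ∈ affineSpan ℝ P, l' x - M' = c * (l x - M) := by
  obtain ⟨y₀, hy₀, hly₀⟩ := hne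
  set F := {y | y ∈ P ∧ l y = M} with hF
  have hFne : F.Nonempty := ⟨y₀, hy₀, hly₀⟩
  have hFP : F ⊆ P := fun y hy => hy.1
  obtain ⟨o, ho, hoF⟩ : ∃ o ∈ P, o ∉ F := by
    by_contra! h
    rw [(show P ⊆ F from h).antisymm hFP] at hd
    omega
  have hlo : l o < M := lt_of_le_of_ne (hl o ho) fun e => hoF ⟨ho, e⟩
  have hspan : affineSpan ℝ (insert o F) = affineSpan ℝ P := by
    refine affineSpan_eq_of_affDim_le (Set.insert_subset ho hFP) (Set.insert_nonempty o F) ?_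
    rw [affDim_insert_of_notMem fun h => hlo.ne (map_eq_of_mem_affineSpan (fun y hy => hy.2) h)]
    omega
  -- The facet and one point `o` of `P` off it span the affine hull, so matching the two functionals
  -- at `o` settles the factor.
  set c := (l' o - M') / (l o - M) with hc
  refine ⟨c, div_nonneg_of_nonpos (sub_nonpos.2 (hl' o ho)) (sub_nonpos.2 hlo.le), ?_⟩
  have hco : c * (l o - M) = l' o - M' := div_mul_cancel₀ _ (sub_neg.2 hlo).ne
  intro x hx
  rw [← hspan] at hx
  have key : ∀ y ∈ insert o F, (l' - c • l) y = M' - c * M := by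
    rintro y (rfl | hy)
    · simp; linarith
    · simp [hsub y hy.1 hy.2, hy.2]
  have := map_eq_of_mem_affineSpan key hx
  simp at this
  linarith

/-- A polytope is cut out from its affine hull by finitely many facet inequalities. -/
theorem IsPolytope.exists_halfspace_representation (hP : IsPolytope P) (hne : P.Nonempty) :
    ∃ S : Finset (StrongDual ℝ V × ℝ),
      (∀ p ∈ S, (∀ y ∈ P, p.1 y ≤ p.2) ∧ {y | y ∈ P ∧ p.1 y = p.2}.Nonempty ∧
        {y | y ∈ P ∧ p.1 y = p.2} ∈ facets P) ∧
      ∀ x ∈ affineSpan ℝ P, (∀ p ∈ S, p.1 x ≤ p.2) → x ∈ P := by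
  classical
  -- The only facet of a single point is the empty set, which is left out.
  have hfin : {F | F ∈ facets P ∧ F.Nonempty}.Finite :=
    hP.finite_faceComplex.subset fun F hF => hF.1.1
  have hchoice : ∀ F : Set V, ∃ p : StrongDual ℝ V × ℝ, F ∈ facets P → F.Nonempty →
      (∀ y ∈ P, p.1 y ≤ p.2) ∧ F = {y | y ∈ P ∧ p.1 y = p.2} := fun F => by
    by_cases hF : F ∈ facets P ∧ F.Nonempty
    · obtain ⟨l, M, h⟩ := exists_level_of_mem_faceComplex hF.1.1 hF.2
      exact ⟨(l, M), fun _ _ => h⟩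
    · exact ⟨0, fun h1 h2 => absurd ⟨h1, h2⟩ hF⟩
  choose p hp using hchoice
  refine ⟨hfin.toFinset.image p, ?_, ?_⟩
  · intro q hq
    obtain ⟨F, hF, rfl⟩ := Finset.mem_image.1 hq
    obtain ⟨hF1, hF2⟩ := (Set.Finite.mem_toFinset _).1 hF
    obtain ⟨h1, h2⟩ := hp F hF1 hF2
    exact ⟨h1, h2 ▸ hF2, h2 ▸ hF1⟩
  · intro x hx hS
    by_contra hxP
    obtain ⟨f, u, hf, hu⟩ := geometric_hahn_banach_closed_point hP.convex
      hP.isCompact.isClosed hxP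
    obtain ⟨y₀, hy₀, hmax⟩ := hP.exists_max hne f
    have hy₀P := vertexSet_subset P hy₀
    have hlt := (hf y₀ hy₀P).trans hu
    -- Rotation about `x` turns the separating hyperplane, shifted to touch `P`, into a facet
    -- hyperplane that `x` violates by the same amount; it is proportional to the functional chosen
    -- for that facet.
    obtain ⟨l, M, h1, h2, h3, h4⟩ :=
      hP.exists_facet_of_level hmax ⟨y₀, hy₀P, rfl⟩ hx hlt.ne'
    have hF : {y | y ∈ P ∧ l y = M} ∈ facets P := ⟨level_mem_faceComplex h1, h3⟩
    have hFne : {y | y ∈ P ∧ l y = M}.Nonempty := ⟨y₀, hy₀P, h2 y₀ hy₀P rfl⟩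
    obtain ⟨h5, h6⟩ := hp _ hF hFne
    have hq := hS _ (Finset.mem_image_of_mem p ((Set.Finite.mem_toFinset hfin).2 ⟨hF, hFne⟩))
    obtain ⟨c, hc, hcx⟩ := facet_functional_unique h1 h5 hFne
      (fun y hy h => (h6.subset ⟨hy, h⟩).2) h3
    obtain ⟨c', hc', hcx'⟩ := facet_functional_unique h5 h1 (by rw [h6] at hFne; exact hFne)
      (fun y hy h => (h6.superset ⟨hy, h⟩).2) (by rw [← h6]; exact h3)
    have e := hcx' x hx
    have : c' * ((p {y | y ∈ P ∧ l y = M}).1 x - (p {y | y ∈ P ∧ l y = M}).2) ≤ 0 :=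
      mul_nonpos_of_nonneg_of_nonpos hc' (sub_nonpos.2 hq)
    linarith

/-- If `v` lies on all facets through `z`, the segment from `v` to `z` extends beyond `z`. -/
theorem IsPolytope.exists_extend (hP : IsPolytope P) {z v : V} (hz : z ∈ P) (hv : v ∈ P)
    (h : ∀ F ∈ facets P, z ∈ F → v ∈ F) : ∃ ε : ℝ, 0 < ε ∧ z + ε • (z - v) ∈ P := by
  obtain ⟨S, hS, hrep⟩ := hP.exists_halfspace_representation ⟨z, hz⟩
  -- An inequality tight at `z` is tight at `v` too, hence along the whole line; the others are
  -- strict at `z` and survive a small step.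
  have hev : ∀ᶠ ε : ℝ in nhdsWithin 0 (Set.Ioi 0), ∀ p ∈ S, p.1 (z + ε • (z - v)) ≤ p.2 := by
    refine (Filter.eventually_all_finset S).2 fun p hp => ?_
    obtain ⟨h1, -, h2⟩ := hS p hp
    by_cases hzp : p.1 z = p.2
    · have := (h _ h2 ⟨hz, hzp⟩).2
      exact Filter.Eventually.of_forall fun ε => by simp [hzp, this]
    · have hlt : p.1 (z + (0 : ℝ) • (z - v)) < p.2 := by
        simpa using lt_of_le_of_ne (h1 z hz) hzp
      have hc : Continuous fun ε : ℝ => p.1 (z + ε • (z - v)) := by fun_prop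
      exact ((hc.tendsto 0).eventually_lt_const hlt).filter_mono nhdsWithin_le_nhds |>.mono
        fun ε hε => hε.le
  obtain ⟨ε, hε, hpos⟩ := (hev.and self_mem_nhdsWithin).exists
  refine ⟨ε, hpos, hrep _ ?_ hε⟩
  exact add_mem_affineSpan (subset_affineSpan ℝ P hz) (Submodule.smul_mem _ _
    (sub_mem_vectorSpan (subset_affineSpan ℝ P hz) (subset_affineSpan ℝ P hv)))

/-- The line from any `y` in `Q` through `p` continues inside `Q` a little beyond `p`, where `l`
would exceed its maximum if `l y` were smaller than `l p`. -/
theorem eq_of_mem_intrinsicInterior {Q : Set V} {p : V} (hp : p ∈ intrinsicInterior ℝ Q)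
    {l : StrongDual ℝ V} {M : ℝ} (hl : ∀ y ∈ Q, l y ≤ M) (hlp : l p = M) : ∀ y ∈ Q, l y = M := by
  intro y hy
  obtain ⟨⟨p, hpQ⟩, hpi, rfl⟩ := mem_intrinsicInterior.1 hp
  simp only at hlp
  have hyQ := subset_affineSpan ℝ Q hy
  let f : ℝ → affineSpan ℝ Q := fun ε => ⟨p + ε • (p - y),
    add_mem_affineSpan hpQ (Submodule.smul_mem _ _ (sub_mem_vectorSpan hpQ hyQ))⟩
  have hf : Continuous f := by
    refine Continuous.subtype_mk ?_ _
    fun_prop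
  have hf0 : f 0 = ⟨p, hpQ⟩ := by simp [f]
  have hev : ∀ᶠ ε in nhdsWithin 0 (Set.Ioi (0 : ℝ)), (f ε : V) ∈ Q := by
    have h1 := hf.tendsto 0
    rw [hf0] at h1
    exact (h1.eventually (mem_interior_iff_mem_nhds.1 hpi)).filter_mono nhdsWithin_le_nhds
  obtain ⟨ε, hε, hpos⟩ := (hev.and self_mem_nhdsWithin).exists
  have h1 := hl _ hε
  simp only [f, map_add, map_smul, map_sub, smul_eq_mul, hlp] at h1
  have h2 := hl y hy
  have hpos : 0 < ε := hpos
  have : M - l y ≤ 0 := by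
    by_contra! h
    have := mul_pos hpos h
    linarith
  linarith

/-- A point of the affine hull outside the relative interior violates, or attains with equality,
some facet inequality. -/
theorem IsPolytope.exists_le_of_notMem_intrinsicInterior (hP : IsPolytope P) (hne : P.Nonempty)
    {x : V} (hx : x ∈ affineSpan ℝ P) (hxi : x ∉ intrinsicInterior ℝ P) :
    ∃ (l : StrongDual ℝ V) (M : ℝ), (∀ y ∈ P, l y ≤ M) ∧ (∃ y ∈ P, l y < M) ∧ M ≤ l x := by
  obtain ⟨S, hS, hrep⟩ := hP.exists_halfspace_representation hne
  by_contra! h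
  apply hxi
  refine mem_intrinsicInterior.2 ⟨⟨x, hx⟩, ?_, rfl⟩
  rw [mem_interior_iff_mem_nhds]
  have hev : ∀ᶠ y : affineSpan ℝ P in nhds ⟨x, hx⟩, ∀ p ∈ S, p.1 y ≤ p.2 := by
    refine (Filter.eventually_all_finset S).2 fun p hp => ?_
    obtain ⟨h1, -, h2⟩ := hS p hp
    have hlt : ∃ y ∈ P, p.1 y < p.2 := by
      by_contra! h3
      have e : {y | y ∈ P ∧ p.1 y = p.2} = P := by
        ext y
        exact ⟨fun hy => hy.1, fun hy => ⟨hy, (h1 y hy).antisymm (h3 y hy)⟩⟩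
      have := h2.2
      rw [e] at this
      omega
    have hc : Continuous fun y : affineSpan ℝ P => p.1 (y : V) := by fun_prop
    exact ((hc.tendsto ⟨x, hx⟩).eventually_lt_const (h p.1 p.2 h1 hlt)).mono fun y hy => hy.le
  filter_upwards [hev] with y hy
  exact hrep y y.2 hy

end Facets

/-! ### Point configurations with a single affine dependency -/

section Circuit

/-- Removes the coercion of the list of indices through the list monad, so that the index is a
natural number. -/
theorem fVector_eq_map {V : Type*} [NormedAddCommGroup V] [NormedSpace ℝ V] (P : Set V) :
    fVector P = (List.range (affDim P + 2).toNat).map fun i : ℕ =>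
      {F | F ∈ faceComplex P ∧ affDim F = (i : ℤ) - 1}.ncard := by
  unfold fVector
  simp only [List.bind_eq_flatMap, List.pure_def, List.map_flatMap,
    List.map_cons, List.map_nil]
  rw [← List.map_eq_flatMap]

theorem sum_smul_mem_affineSpan {V ι : Type*} [NormedAddCommGroup V] [NormedSpace ℝ V] {S : Set V}
    {s : Finset ι} {w : ι → ℝ} {p : ι → V} (hw : ∑ i ∈ s, w i = 1)
    (hp : ∀ i ∈ s, p i ∈ affineSpan ℝ S) : ∑ i ∈ s, w i • p i ∈ affineSpan ℝ S := by
  obtain ⟨j, hj⟩ : s.Nonempty := Finset.nonempty_of_sum_ne_zero (hw ▸ one_ne_zero)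
  have e : ∑ i ∈ s, w i • p i = p j + ∑ i ∈ s, w i • (p i - p j) := by
    simp [smul_sub, Finset.sum_sub_distrib, ← Finset.sum_smul, hw]
  rw [e]
  exact add_mem_affineSpan (hp j hj) (Submodule.sum_mem _ fun i hi =>
    Submodule.smul_mem _ _ (sub_mem_vectorSpan (hp i hi) (hp j hj)))

/-- `x` has, up to scaling, exactly one affine dependency, namely `g`. -/
structure IsAffineCircuit {V ι : Type*} [AddCommGroup V] [Module ℝ V] [Fintype ι] (x : ι → V)
    (g : ι → ℝ) : Prop where
  sum_eq : ∑ i, g i = 0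
  sum_smul_eq : ∑ i, g i • x i = 0
  ne_zero : g ≠ 0
  unique : ∀ c : ι → ℝ, ∑ i, c i = 0 → ∑ i, c i • x i = 0 → ∃ r : ℝ, c = r • g

variable {V ι : Type*} [NormedAddCommGroup V] [NormedSpace ℝ V] [Fintype ι]

/-- The space of affine dependencies of a finite family. -/
def affineDependencies (x : ι → V) : Submodule ℝ (ι → ℝ) where
  carrier := {c | ∑ i, c i = 0 ∧ ∑ i, c i • x i = 0}
  add_mem' := fun {a b} ha hb => by
    simp [add_smul, Finset.sum_add_distrib, ha.1, ha.2, hb.1, hb.2]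
  zero_mem' := by simp
  smul_mem' := fun r a ha => by
    simp [mul_smul, ← Finset.mul_sum, ← Finset.smul_sum, ha.1, ha.2]

theorem mem_affineDependencies {x : ι → V} {c : ι → ℝ} :
    c ∈ affineDependencies x ↔ ∑ i, c i = 0 ∧ ∑ i, c i • x i = 0 := Iff.rfl

/-- Rank–nullity twice: for the coefficient sum, and for the weighted sum of the points on
coefficient vectors of sum zero, whose range is the vector span. -/
theorem finrank_affineDependencies [Nonempty ι] (x : ι → V) :
    Module.finrank ℝ (vectorSpan ℝ (Set.range x)) + Module.finrank ℝ (affineDependencies x) + 1 =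
      Fintype.card ι := by
  classical
  let σ : (ι → ℝ) →ₗ[ℝ] ℝ := Fintype.linearCombination ℝ (fun _ : ι => (1 : ℝ))
  have hσ : ∀ c, σ c = ∑ i, c i := fun c => by simp [σ, Fintype.linearCombination_apply]
  have hσs : Function.Surjective σ := fun r => by
    obtain ⟨i⟩ := ‹Nonempty ι›
    exact ⟨Pi.single i r, by simp [hσ]⟩
  have h1 := LinearMap.finrank_range_add_finrank_ker σ
  rw [LinearMap.range_eq_top.2 hσs, finrank_top, Module.finrank_self,
    Module.finrank_fintype_fun_eq_card] at h1
  let φ : LinearMap.ker σ →ₗ[ℝ] V := (Fintype.linearCombination ℝ x).domRestrict (LinearMap.ker σ)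
  have hφ : ∀ c, φ c = ∑ i, (c : ι → ℝ) i • x i := fun c => by
    simp [φ, Fintype.linearCombination_apply]
  have h2 := LinearMap.finrank_range_add_finrank_ker φ
  have hr : LinearMap.range φ = vectorSpan ℝ (Set.range x) := by
    apply le_antisymm
    · rintro _ ⟨⟨c, hc⟩, rfl⟩
      obtain ⟨j⟩ := ‹Nonempty ι›
      rw [LinearMap.mem_ker, hσ] at hc
      have : φ ⟨c, by rw [LinearMap.mem_ker, hσ, hc]⟩ = ∑ i, c i • (x i - x j) := by
        rw [hφ]
        simp [smul_sub, Finset.sum_sub_distrib, ← Finset.sum_smul, hc]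
      rw [this]
      exact Submodule.sum_mem _ fun i _ => Submodule.smul_mem _ _
        (vsub_mem_vectorSpan ℝ ⟨i, rfl⟩ ⟨j, rfl⟩)
    · refine Submodule.span_le.2 ?_
      rintro _ ⟨_, ⟨i, rfl⟩, _, ⟨j, rfl⟩, rfl⟩
      refine ⟨⟨Pi.single i 1 - Pi.single j 1, ?_⟩, ?_⟩
      · rw [LinearMap.mem_ker, hσ]; simp
      · rw [hφ]; simp [sub_smul, Pi.single_apply]
  have hk : Module.finrank ℝ (LinearMap.ker φ) = Module.finrank ℝ (affineDependencies x) := by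
    have e : (LinearMap.ker φ).map (LinearMap.ker σ).subtype = affineDependencies x := by
      ext c
      simp only [Submodule.mem_map, LinearMap.mem_ker, hφ, mem_affineDependencies,
        Submodule.subtype_apply]
      constructor
      · rintro ⟨⟨c, hc⟩, h, rfl⟩
        exact ⟨by rw [LinearMap.mem_ker, hσ] at hc; exact hc, h⟩
      · rintro ⟨h, h'⟩
        exact ⟨⟨c, by rw [LinearMap.mem_ker, hσ, h]⟩, h', rfl⟩
    rw [← e]
    exact (LinearEquiv.finrank_eq (Submodule.equivMapOfInjective _
      (Submodule.subtype_injective _) _))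
  rw [hr, hk] at h2
  omega

theorem affDim_range_of_independent {x : ι → V}
    (h : ∀ c : ι → ℝ, ∑ i, c i = 0 → ∑ i, c i • x i = 0 → c = 0) :
    affDim (Set.range x) = Fintype.card ι - 1 := by
  cases isEmpty_or_nonempty ι
  · simp [Set.range_eq_empty, affDim_empty]
  · have h1 := finrank_affineDependencies x
    have h2 : affineDependencies x = ⊥ := by
      rw [Submodule.eq_bot_iff]
      exact fun c hc => h c hc.1 hc.2
    rw [h2, finrank_bot] at h1
    rw [affDim_of_nonempty (Set.range_nonempty x)]
    omega

theorem exists_isAffineCircuit {x : ι → V} (hne : Nonempty ι)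
    (h : affDim (Set.range x) = Fintype.card ι - 2) : ∃ g, IsAffineCircuit x g := by
  have h1 := finrank_affineDependencies x
  rw [affDim_of_nonempty (Set.range_nonempty x)] at h
  have h2 : Module.finrank ℝ (affineDependencies x) = 1 := by omega
  obtain ⟨⟨g, hg⟩, hg0, hu⟩ := finrank_eq_one_iff'.1 h2
  refine ⟨g, hg.1, hg.2, fun e => hg0 (by simp [e]), fun c hc hc' => ?_⟩
  obtain ⟨r, hr⟩ := hu ⟨c, hc, hc'⟩
  exact ⟨r, (congrArg Subtype.val hr).symm⟩

namespace IsAffineCircuit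

variable {x : ι → V} {g : ι → ℝ}

theorem smul (h : IsAffineCircuit x g) {r : ℝ} (hr : r ≠ 0) : IsAffineCircuit x (r • g) where
  sum_eq := by simp [← Finset.mul_sum, h.sum_eq]
  sum_smul_eq := by simp [mul_smul, ← Finset.smul_sum, h.sum_smul_eq]
  ne_zero := smul_ne_zero hr h.ne_zero
  unique c hc hc' := by
    obtain ⟨s, hs⟩ := h.unique c hc hc'
    exact ⟨s / r, by rw [smul_smul, div_mul_cancel₀ _ hr, hs]⟩

theorem of_dependency (h : IsAffineCircuit x g) {c : ι → ℝ} (hc : ∑ i, c i = 0)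
    (hc' : ∑ i, c i • x i = 0) (hne : c ≠ 0) : IsAffineCircuit x c := by
  obtain ⟨r, rfl⟩ := h.unique c hc hc'
  exact h.smul fun e => hne (by simp [e])

theorem exists_pos (h : IsAffineCircuit x g) : ∃ i, 0 < g i := by
  by_contra! hn
  apply h.ne_zero
  ext i
  exact (Finset.sum_eq_zero_iff_of_nonpos fun i _ => hn i).1 h.sum_eq i (Finset.mem_univ i)

theorem exists_neg (h : IsAffineCircuit x g) : ∃ i, g i < 0 := by
  by_contra! hn
  apply h.ne_zero
  ext i
  exact (Finset.sum_eq_zero_iff_of_nonneg fun i _ => hn i).1 h.sum_eq i (Finset.mem_univ i)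

/-- Gale duality: the value vectors of affine functions on the points form the orthogonal complement
of the dependencies. A `y` outside this space is detected by a linear form vanishing on it; the
coefficients of that form are a dependency, hence a multiple of `g`, which kills `y`. -/
theorem exists_functional (h : IsAffineCircuit x g) [FiniteDimensional ℝ V] {y : ι → ℝ}
    (hy : ∑ i, g i * y i = 0) : ∃ (l : StrongDual ℝ V) (M : ℝ), ∀ i, M - l (x i) = y i := by
  classical
  let Ψ : (StrongDual ℝ V × ℝ) →ₗ[ℝ] (ι → ℝ) :=
    { toFun := fun p i => p.2 - p.1 (x i)
      map_add' := fun p q => by ext i; simp; ring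
      map_smul' := fun r p => by ext i; simp; ring }
  suffices hmem : y ∈ LinearMap.range Ψ by
    obtain ⟨⟨l, M⟩, rfl⟩ := hmem
    exact ⟨l, M, fun i => rfl⟩
  by_contra hmem
  obtain ⟨f, hf, hfy⟩ := exists_strongDual_of_notMem hmem 1
  set c : ι → ℝ := fun i => f (Pi.single i 1) with hc
  have hfc : ∀ z : ι → ℝ, f z = ∑ i, c i * z i := fun z => by
    conv_lhs => rw [pi_eq_sum_univ' z]
    simp only [map_sum, map_smul, smul_eq_mul, hc]
    refine Finset.sum_congr rfl fun i _ => ?_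
    rw [mul_comm]
  have h1 : ∑ i, c i = 0 := by
    have := hf _ ⟨(0, 1), rfl⟩
    rw [hfc] at this
    simpa [Ψ] using this
  have h2 : ∑ i, c i • x i = 0 := by
    refine (SeparatingDual.eq_zero_iff_forall_dual_eq_zero (R := ℝ) _).2 fun l => ?_
    have := hf _ ⟨(l, 0), rfl⟩
    rw [hfc] at this
    simpa [Ψ] using this
  obtain ⟨r, hr⟩ := h.unique c h1 h2
  rw [hfc, hr] at hfy
  simp [mul_assoc, ← Finset.mul_sum, hy] at hfy

end IsAffineCircuit

/-- The combinatorial faces of a configuration with a single affine dependency, whose positive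
and negative supports are `p` and `n`. -/
abbrev IsCircuitFace [DecidableEq ι] (p n J : Finset ι) : Prop := (∃ i ∈ p, i ∉ J) ↔ ∃ i ∈ n, i ∉ J

/-- The dimension of the hull of the points indexed by `J`. -/
abbrev circuitDim [DecidableEq ι] (p n J : Finset ι) : ℤ :=
  J.card - 1 - if p ∪ n ⊆ J then 1 else 0

namespace IsAffineCircuit

variable [DecidableEq ι] {x : ι → V} {g : ι → ℝ}

/-- A supporting functional amounts to a nonnegative `y` orthogonal to `g` whose zero set is `J`.
Such a `y` exists exactly when `g` has both signs off `J`, or neither. -/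
theorem isCircuitFace_iff (h : IsAffineCircuit x g) [FiniteDimensional ℝ V] (J : Finset ι) :
    IsCircuitFace {i | 0 < g i} {i | g i < 0} J ↔
      ∃ (l : StrongDual ℝ V) (M : ℝ), (∀ i, l (x i) ≤ M) ∧ ∀ i, l (x i) = M ↔ i ∈ J := by
  constructor
  · intro hJ
    obtain ⟨y, hy0, hyJ, hgy⟩ : ∃ y : ι → ℝ, (∀ i, 0 ≤ y i) ∧ (∀ i, y i = 0 ↔ i ∈ J) ∧
        ∑ i, g i * y i = 0 := by
      by_cases hp : ∃ i ∈ Finset.univ.filter (fun i => 0 < g i), i ∉ J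
      · obtain ⟨j, hj, hjJ⟩ := hJ.1 hp
        obtain ⟨i, hi, hiJ⟩ := hp
        simp only [Finset.mem_filter, Finset.mem_univ, true_and] at hi hj
        set A := ∑ i, (if i ∉ J ∧ 0 < g i then g i else 0) with hA
        set B := ∑ i, (if i ∉ J ∧ g i < 0 then -g i else 0) with hB
        have hApos : 0 < A := by
          refine Finset.sum_pos' (fun k _ => ?_) ⟨i, Finset.mem_univ i, by simp [hiJ, hi]⟩
          split_ifs with hk
          exacts [hk.2.le, le_rfl]
        have hBpos : 0 < B := by
          refine Finset.sum_pos' (fun k _ => ?_) ⟨j, Finset.mem_univ j, by simp [hjJ, hj]⟩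
          split_ifs with hk
          exacts [by linarith [hk.2], le_rfl]
        -- The positive part off `J` sums to `A` and the negative part to `-B`; weights `B` and `A`
        -- make them cancel.
        refine ⟨fun i => if i ∈ J then 0 else if 0 < g i then B else if g i < 0 then A else 1,
          fun k => ?_, fun k => ?_, ?_⟩
        · dsimp only; split_ifs <;> linarith
        · dsimp only; split_ifs with h1 h2 h3
          exacts [iff_of_true rfl h1, iff_of_false hBpos.ne' h1, iff_of_false hApos.ne' h1,
            iff_of_false one_ne_zero h1]
        · have e : ∀ k, g k * (if k ∈ J then 0 else if 0 < g k then B else if g k < 0 then A else 1)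
              = B * (if k ∉ J ∧ 0 < g k then g k else 0) -
                A * (if k ∉ J ∧ g k < 0 then -g k else 0) := fun k => by
            by_cases h1 : k ∈ J
            · simp [h1]
            · rcases lt_trichotomy (g k) 0 with h2 | h2 | h2
              · simp [h1, h2, h2.not_gt]; ring
              · simp [h1, h2]
              · simp [h1, h2, h2.not_gt]; ring
          simp only [e]
          rw [Finset.sum_sub_distrib, ← Finset.mul_sum, ← Finset.mul_sum, ← hA, ← hB]
          ring
      · have hn := mt hJ.2 hp
        simp only [Finset.mem_filter, Finset.mem_univ, true_and, not_exists, not_and,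
          not_not] at hp hn
        -- Here `g` vanishes off `J`, so any positive weights there will do.
        refine ⟨fun i => if i ∈ J then 0 else 1, fun k => ?_, fun k => ?_, ?_⟩
        · dsimp only; split_ifs <;> norm_num
        · by_cases h1 : k ∈ J <;> simp [h1]
        · refine Finset.sum_eq_zero fun k _ => ?_
          rcases lt_trichotomy (g k) 0 with h2 | h2 | h2
          · simp [hn k h2]
          · simp [h2]
          · simp [hp k h2]
    obtain ⟨l, M, hl⟩ := h.exists_functional hgy
    exact ⟨l, M, fun i => by linarith [hl i, hy0 i], fun i => by
      rw [← hyJ, ← hl i]; constructor <;> intro <;> linarith⟩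
  · rintro ⟨l, M, hl, hJ⟩
    have hsum : ∑ i, g i * (M - l (x i)) = 0 := by
      have h1 : ∑ i, g i * l (x i) = l (∑ i, g i • x i) := by simp
      rw [h.sum_smul_eq, map_zero] at h1
      simp only [mul_sub, Finset.sum_sub_distrib, h1, ← Finset.sum_mul, h.sum_eq]
      simp
    have hpos : ∀ i, i ∉ J → 0 < M - l (x i) := fun i hi =>
      sub_pos.2 (lt_of_le_of_ne (hl i) fun e => hi ((hJ i).1 e))
    have hz : ∀ i, i ∈ J → M - l (x i) = 0 := fun i hi => sub_eq_zero.2 ((hJ i).2 hi).symm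
    constructor
    · rintro ⟨i, hi, hiJ⟩
      simp only [Finset.mem_filter, Finset.mem_univ, true_and] at hi ⊢
      by_contra! hn
      refine hsum.not_gt (Finset.sum_pos' (fun k _ => ?_)
        ⟨i, Finset.mem_univ i, mul_pos hi (hpos i hiJ)⟩)
      by_cases hk : k ∈ J
      · simp [hz k hk]
      · exact mul_nonneg (not_lt.1 fun hg => hk (hn k hg)) (hpos k hk).le
    · rintro ⟨i, hi, hiJ⟩
      simp only [Finset.mem_filter, Finset.mem_univ, true_and] at hi ⊢
      by_contra! hn
      refine hsum.not_lt (Finset.sum_neg' (fun k _ => ?_)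
        ⟨i, Finset.mem_univ i, mul_neg_of_neg_of_pos hi (hpos i hiJ)⟩)
      by_cases hk : k ∈ J
      · simp [hz k hk]
      · exact mul_nonpos_of_nonpos_of_nonneg (not_lt.1 fun hg => hk (hn k hg)) (hpos k hk).le

/-- A dependency on `J`, extended by zero, is a multiple of `g` that vanishes at `i`, hence zero:
the points indexed by `J` are affinely independent. -/
theorem affDim_image_of_notMem (h : IsAffineCircuit x g) {J : Finset ι} {i : ι} (hi : i ∉ J)
    (hgi : g i ≠ 0) : affDim (x '' J) = J.card - 1 := by
  have : x '' (J : Set ι) = Set.range fun j : J => x j := by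
    ext; simp
  rw [this, affDim_range_of_independent, Fintype.card_coe]
  intro c hc hc'
  set c' : ι → ℝ := fun i => if hi : i ∈ J then c ⟨i, hi⟩ else 0 with hc'def
  have h1 : ∑ i, c' i = 0 := by
    rw [← Finset.sum_subset (Finset.subset_univ J) (by intro k _ hk; simp [c', hk]),
      ← Finset.sum_coe_sort J]
    simpa [c'] using hc
  have h2 : ∑ i, c' i • x i = 0 := by
    rw [← Finset.sum_subset (Finset.subset_univ J) (by intro k _ hk; simp [c', hk]),
      ← Finset.sum_coe_sort J]
    simpa [c'] using hc'
  obtain ⟨r, hr⟩ := h.unique c' h1 h2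
  have hr0 : r = 0 := by
    have := congrFun hr i
    simp only [c', hi, dif_neg, not_false_eq_true, Pi.smul_apply, smul_eq_mul] at this
    exact (mul_eq_zero.1 this.symm).resolve_right hgi
  ext j
  have := congrFun hr j
  simpa [c', hr0] using this

theorem affDim_image (h : IsAffineCircuit x g) (J : Finset ι) :
    affDim (x '' J) = circuitDim {i | 0 < g i} {i | g i < 0} J := by
  unfold circuitDim
  split_ifs with hJ
  · obtain ⟨i, hi⟩ := h.exists_pos
    have hsupp : ∀ k, g k ≠ 0 → k ∈ J := fun k hk => hJ (by
      rcases hk.lt_or_gt with hk | hk <;> simp [hk])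
    have hiJ := hsupp i hi.ne'
    -- When `J` contains the whole support, solving the dependency for `x i` shows that this point
    -- is redundant for the span; the remaining ones are independent.
    have hx : x i ∈ affineSpan ℝ (x '' (J.erase i : Finset ι)) := by
      have hsum : ∑ k ∈ J.erase i, -(g i)⁻¹ * g k = 1 := by
        have h1 : ∑ k ∈ J, g k = 0 := by
          rw [Finset.sum_subset (Finset.subset_univ J), h.sum_eq]
          exact fun k _ hk => by_contra fun e => hk (hsupp k e)
        rw [← Finset.add_sum_erase J g hiJ] at h1
        rw [← Finset.mul_sum]
        field_simp
        linarith
      have hmem := sum_smul_mem_affineSpan (p := x) hsum fun k hk =>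
        subset_affineSpan ℝ _ (Set.mem_image_of_mem x (Finset.mem_coe.2 hk))
      convert hmem
      have h1 : ∑ k ∈ J, g k • x k = 0 := by
        rw [Finset.sum_subset (Finset.subset_univ J), h.sum_smul_eq]
        exact fun k _ hk => by rw [by_contra fun e => hk (hsupp k e), zero_smul]
      rw [← Finset.add_sum_erase J _ hiJ] at h1
      simp only [mul_smul, ← Finset.smul_sum]
      rw [neg_smul, eq_neg_iff_add_eq_zero]
      have h2 := congrArg (fun v => (g i)⁻¹ • v) h1
      simpa [smul_smul, hi.ne'] using h2
    have e : x '' J = insert (x i) (x '' (J.erase i : Finset ι)) := by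
      rw [← Set.image_insert_eq, ← Finset.coe_insert, Finset.insert_erase hiJ]
    rw [e, affDim_insert_of_mem hx, h.affDim_image_of_notMem (Finset.notMem_erase i J) hi.ne',
      Finset.card_erase_of_mem hiJ]
    have := Finset.card_pos.2 ⟨i, hiJ⟩
    omega
  · obtain ⟨i, hi, hiJ⟩ := Finset.not_subset.1 hJ
    rw [h.affDim_image_of_notMem hiJ]
    · ring
    · rcases Finset.mem_union.1 hi with hi | hi
      · exact (Finset.mem_filter.1 hi).2.ne'
      · exact (Finset.mem_filter.1 hi).2.ne

theorem affDim_range (h : IsAffineCircuit x g) :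
    affDim (Set.range x) = Fintype.card ι - 2 := by
  have := h.affDim_image Finset.univ
  simp only [Finset.coe_univ, Set.image_univ] at this
  rw [this]
  simp [circuitDim]
  ring

variable [FiniteDimensional ℝ V]

theorem exists_level_of_isCircuitFace (h : IsAffineCircuit x g) {J : Finset ι}
    (hJ : IsCircuitFace {i | 0 < g i} {i | g i < 0} J) :
    convexHull ℝ (x '' J) ∈ faceComplex (convexHull ℝ (Set.range x)) ∧
      ∀ i, x i ∈ convexHull ℝ (x '' J) ↔ i ∈ J := by
  obtain ⟨l, M, hl, hlJ⟩ := (h.isCircuitFace_iff J).1 hJ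
  have hval : ∀ z ∈ Set.range x, l z ≤ M := by
    rintro _ ⟨i, rfl⟩
    exact hl i
  have e : {z | z ∈ Set.range x ∧ l z = M} = x '' J := by
    ext z
    constructor
    · rintro ⟨⟨i, rfl⟩, hi⟩
      exact ⟨i, (hlJ i).1 hi, rfl⟩
    · rintro ⟨i, hi, rfl⟩
      exact ⟨⟨i, rfl⟩, (hlJ i).2 hi⟩
  have e' := convexHull_inter_level hval
  rw [e] at e'
  rw [← e']
  refine ⟨level_mem_faceComplex fun z hz => le_of_mem_convexHull hval hz, fun i => ?_⟩
  rw [← hlJ i]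
  exact ⟨fun hi => hi.2, fun hi => ⟨subset_convexHull ℝ _ ⟨i, rfl⟩, hi⟩⟩

theorem exists_isCircuitFace (h : IsAffineCircuit x g) {F : Set V}
    (hF : F ∈ faceComplex (convexHull ℝ (Set.range x))) :
    ∃ J : Finset ι, IsCircuitFace {i | 0 < g i} {i | g i < 0} J ∧ F = convexHull ℝ (x '' J) := by
  classical
  by_cases hne : F.Nonempty
  · obtain ⟨l, M, hl, rfl⟩ := exists_level_of_mem_faceComplex hF hne
    have hl' : ∀ z ∈ Set.range x, l z ≤ M := fun z hz => hl z (subset_convexHull ℝ _ hz)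
    refine ⟨Finset.univ.filter fun i => l (x i) = M, (h.isCircuitFace_iff _).2
      ⟨l, M, fun i => hl' _ ⟨i, rfl⟩, by simp⟩, ?_⟩
    rw [convexHull_inter_level hl']
    congr 1
    ext z
    simp
    grind
  -- The empty index set is a circuit face because `g` takes both signs.
  · refine ⟨∅, ?_, by simp [Set.not_nonempty_iff_eq_empty.1 hne]⟩
    obtain ⟨i, hi⟩ := h.exists_pos
    obtain ⟨j, hj⟩ := h.exists_neg
    exact ⟨fun _ => ⟨j, by simp [hj]⟩, fun _ => ⟨i, by simp [hi]⟩⟩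

theorem ncard_faces (h : IsAffineCircuit x g) (d : ℤ) :
    {F | F ∈ faceComplex (convexHull ℝ (Set.range x)) ∧ affDim F = d}.ncard =
      (Finset.univ.filter fun J : Finset ι => IsCircuitFace {i | 0 < g i} {i | g i < 0} J ∧
        circuitDim {i | 0 < g i} {i | g i < 0} J = d).card := by
  rw [← Set.ncard_coe_finset, ← Set.InjOn.ncard_image (f := fun J : Finset ι =>
    convexHull ℝ (x '' (J : Set ι)))]
  · congr 1
    ext F
    simp only [Set.mem_ofPred_eq, Finset.coe_filter, Finset.mem_univ, true_and, Set.mem_image]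
    constructor
    · rintro ⟨hF, hd⟩
      obtain ⟨J, hJ, rfl⟩ := h.exists_isCircuitFace hF
      exact ⟨J, ⟨hJ, by rw [← hd, affDim_convexHull, h.affDim_image]⟩, rfl⟩
    · rintro ⟨J, ⟨hJ, hd⟩, rfl⟩
      exact ⟨(h.exists_level_of_isCircuitFace hJ).1, by
        rw [affDim_convexHull, h.affDim_image, hd]⟩
  · intro J hJ K hK hJK
    simp only [Finset.coe_filter, Finset.mem_univ, true_and, Set.mem_ofPred_eq] at hJ hK hJK
    ext i
    rw [← (h.exists_level_of_isCircuitFace hJ.1).2, ← (h.exists_level_of_isCircuitFace hK.1).2, hJK]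

theorem fVector_eq (h : IsAffineCircuit x g) :
    fVector (convexHull ℝ (Set.range x)) = (List.range (Fintype.card ι)).map fun d : ℕ =>
      (Finset.univ.filter fun J : Finset ι => IsCircuitFace {i | 0 < g i} {i | g i < 0} J ∧
        circuitDim {i | 0 < g i} {i | g i < 0} J = d - 1).card := by
  rw [fVector_eq_map, affDim_convexHull, h.affDim_range]
  simp only [h.ncard_faces]
  rw [show ((Fintype.card ι : ℤ) - 2 + 2).toNat = Fintype.card ι by omega]

end IsAffineCircuit

end Circuit

/-! ### Special simplices of codimension one -/

section SpecialSimplex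

variable {V : Type*} [NormedAddCommGroup V] [NormedSpace ℝ V] [FiniteDimensional ℝ V] {P : Set V}

theorem affDim_eq_zero_iff {S : Set V} : affDim S = 0 ↔ ∃ v, S = {v} := by
  constructor
  · intro h
    obtain ⟨v, hv⟩ := affDim_nonneg_iff.1 h.ge
    refine ⟨v, Set.eq_singleton_iff_unique_mem.2 ⟨hv, fun y hy => ?_⟩⟩
    rw [affDim_of_nonempty ⟨v, hv⟩] at h
    have h0 : vectorSpan ℝ S = ⊥ := Submodule.finrank_eq_zero.1 (by exact_mod_cast h)
    have := vsub_mem_vectorSpan ℝ hy hv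
    rw [h0, Submodule.mem_bot, vsub_eq_sub, sub_eq_zero] at this
    exact this
  · rintro ⟨v, rfl⟩
    exact affDim_singleton v

theorem ncard_faces_affDim_zero (P : Set V) :
    {F | F ∈ faceComplex P ∧ affDim F = 0}.ncard = (vertexSet P).ncard := by
  rw [← Set.ncard_image_of_injective (vertexSet P) Set.singleton_injective]
  congr 1
  ext F
  simp only [Set.mem_ofPred_eq, affDim_eq_zero_iff, Set.mem_image]
  constructor
  · rintro ⟨h, v, rfl⟩
    exact ⟨v, h, rfl⟩
  · rintro ⟨v, hv, rfl⟩
    exact ⟨hv, v, rfl⟩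

theorem affDim_add_two_of_fVector {L : List ℕ} (h : fVector P = L) :
    (affDim P + 2).toNat = L.length := by
  rw [← h, fVector_eq_map]; simp

theorem ncard_of_fVector {L : List ℕ} (h : fVector P = L) {i : ℕ} (hi : i < L.length) :
    {F | F ∈ faceComplex P ∧ affDim F = (i : ℤ) - 1}.ncard = L[i] := by
  subst h
  simp [fVector_eq_map]

theorem affDim_basisPolytope {m : ℕ} (s : Affine.Simplex ℝ V m) (hs : Set.range s.points ⊆ P) :
    affDim (basisPolytope P s) = affDim P - m := by
  have hne : P.Nonempty := (Set.range_nonempty s.points).mono hs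
  rw [affDim_of_nonempty hne, basisPolytope, affDim_of_nonempty (hne.image _)]
  set K := vectorSpan ℝ (Set.range s.points) with hK
  have hKf : Module.finrank ℝ K = m := s.independent.finrank_vectorSpan (by simp)
  have hle : K ≤ vectorSpan ℝ P := vectorSpan_mono ℝ hs
  have h1 : vectorSpan ℝ (K.mkQ '' P) = (vectorSpan ℝ P).map K.mkQ :=
    (AffineMap.map_vectorSpan K.mkQ.toAffineMap).symm
  have h2 := LinearMap.finrank_range_add_finrank_ker (K.mkQ.domRestrict (vectorSpan ℝ P))
  have h3 : LinearMap.ker (K.mkQ.domRestrict (vectorSpan ℝ P)) =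
      K.comap (vectorSpan ℝ P).subtype := by
    ext y; simp
  rw [LinearMap.range_domRestrict, h3, (Submodule.comapSubtypeEquivOfLe hle).finrank_eq, hKf,
    ← h1] at h2
  omega

/-- The combinatorial content of a circuit with two positive points `inr 0`, `inr 1`. -/
theorem circuit_combinatorics_one (N : Finset (Fin 2)) (hN : 2 ≤ N.card) :
    ((List.range 4).map fun d : ℕ => (Finset.univ.filter fun J : Finset (Fin 2 ⊕ Fin 2) =>
      IsCircuitFace (Finset.univ.image Sum.inr) (N.image Sum.inl) J ∧
      circuitDim (Finset.univ.image Sum.inr) (N.image Sum.inl) J = d - 1).card) = [1, 4, 4, 1] ∧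
    ∀ J : Finset (Fin 2 ⊕ Fin 2),
      IsCircuitFace (Finset.univ.image Sum.inr) (N.image Sum.inl) J →
      circuitDim (Finset.univ.image Sum.inr) (N.image Sum.inl) J = 1 →
      (Finset.univ.filter fun i => Sum.inl i ∈ J).card = 1 := by
  revert N
  decide +kernel

/-- `inl` indexes the simplex, `inr` the two other vertices, and `N` the negative coefficients.
Three negatives describe the triangular bipyramid; two describe the pyramid over a quadrilateral,
the point with coefficient zero being its apex. -/
theorem circuit_combinatorics_two (N : Finset (Fin 3)) (hN : 2 ≤ N.card) :
    (((List.range 5).map fun d : ℕ => (Finset.univ.filter fun J : Finset (Fin 3 ⊕ Fin 2) =>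
      IsCircuitFace (Finset.univ.image Sum.inr) (N.image Sum.inl) J ∧
      circuitDim (Finset.univ.image Sum.inr) (N.image Sum.inl) J = d - 1).card) = [1, 5, 9, 6, 1] ∨
    ((List.range 5).map fun d : ℕ => (Finset.univ.filter fun J : Finset (Fin 3 ⊕ Fin 2) =>
      IsCircuitFace (Finset.univ.image Sum.inr) (N.image Sum.inl) J ∧
      circuitDim (Finset.univ.image Sum.inr) (N.image Sum.inl) J = d - 1).card) = [1, 5, 8, 5, 1]) ∧
    ∀ J : Finset (Fin 3 ⊕ Fin 2),
      IsCircuitFace (Finset.univ.image Sum.inr) (N.image Sum.inl) J →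
      circuitDim (Finset.univ.image Sum.inr) (N.image Sum.inl) J = 2 →
      (Finset.univ.filter fun i => Sum.inl i ∈ J).card = 2 := by
  revert N
  decide +kernel

/-- Normal form of an `(m + 1)`-polytope with `m + 3` vertices whose affine dependency has exactly
two positive coefficients. -/
structure IsTwoCircuit {m : ℕ} (x : Fin (m + 1) ⊕ Fin 2 → V) (g : Fin (m + 1) ⊕ Fin 2 → ℝ) : Prop
    extends IsAffineCircuit x g where
  pos : ∀ j, 0 < g (Sum.inr j)
  nonpos : ∀ i, g (Sum.inl i) ≤ 0
  two_le : 2 ≤ (Finset.univ.filter fun i => g (Sum.inl i) < 0).card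

namespace IsTwoCircuit

variable {m : ℕ} {x : Fin (m + 1) ⊕ Fin 2 → V} {g : Fin (m + 1) ⊕ Fin 2 → ℝ}

theorem filter_pos (h : IsTwoCircuit x g) :
    Finset.univ.filter (fun i => 0 < g i) = Finset.univ.image Sum.inr := by
  ext (i | j)
  · simpa using h.nonpos i
  · simpa using h.pos j

theorem filter_neg (h : IsTwoCircuit x g) : Finset.univ.filter (fun i => g i < 0) =
    (Finset.univ.filter fun i => g (Sum.inl i) < 0).image Sum.inl := by
  ext (i | j)
  · simp
  · simpa using (h.pos j).le

/-- Each sign occurs at least twice, so both signs remain after one index is removed. -/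
theorem isCircuitFace_singleton (h : IsTwoCircuit x g) (k : Fin (m + 1) ⊕ Fin 2) :
    IsCircuitFace {i | 0 < g i} {i | g i < 0} {k} := by
  obtain ⟨i, hi, j, hj, hij⟩ := Finset.one_lt_card.1 h.two_le
  simp only [Finset.mem_filter, Finset.mem_univ, true_and] at hi hj
  refine iff_of_true ?_ ?_
  · rcases k with k | k
    · exact ⟨Sum.inr 0, by simpa using h.pos 0, by simp⟩
    · obtain ⟨k', hk'⟩ := exists_ne k
      exact ⟨Sum.inr k', by simpa using h.pos k', by simpa using hk'⟩
  · rcases k with k | k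
    · by_cases hik : i = k
      · exact ⟨Sum.inl j, by simpa using hj, by simpa [← hik] using hij.symm⟩
      · exact ⟨Sum.inl i, by simpa using hi, by simpa using hik⟩
    · exact ⟨Sum.inl i, by simpa using hi, by simp⟩

theorem mem_vertexSet (h : IsTwoCircuit x g) (k : Fin (m + 1) ⊕ Fin 2) :
    x k ∈ vertexSet (convexHull ℝ (Set.range x)) := by
  have := (h.exists_level_of_isCircuitFace (h.isCircuitFace_singleton k)).1
  simpa [vertexSet] using this

theorem injective (h : IsTwoCircuit x g) : Function.Injective x := by
  intro k k' hk
  have := (h.exists_level_of_isCircuitFace (h.isCircuitFace_singleton k)).2 k'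
  simpa [hk, eq_comm] using this

theorem affDim_eq (h : IsTwoCircuit x g) : affDim (convexHull ℝ (Set.range x)) = m + 1 := by
  rw [affDim_convexHull, h.affDim_range]
  simp

/-- Faces avoiding the simplex lie on the segment between the two `inr` vertices, and these vertices
are such faces themselves. The complex thus spans a line, and the basis polytope has dimension `(m +
1) - m = 1`. -/
theorem isMeek (h : IsTwoCircuit x g) (s : Affine.Simplex ℝ V m)
    (hs : ∀ i, s.points i = x (Sum.inl i)) : IsMeek (convexHull ℝ (Set.range x)) s := by
  have hsub : Set.range s.points ⊆ convexHull ℝ (Set.range x) := by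
    rintro _ ⟨i, rfl⟩
    exact hs i ▸ subset_convexHull ℝ _ ⟨_, rfl⟩
  rw [IsMeek, affDim_basisPolytope s hsub, h.affDim_eq, affDim_affineSpan]
  have hmem : ∀ j, x (Sum.inr j) ∈ ⋃₀ avoidingComplex (convexHull ℝ (Set.range x)) s := fun j => by
    refine ⟨{x (Sum.inr j)}, ⟨h.mem_vertexSet _, fun i => ?_⟩, rfl⟩
    rw [hs]
    exact fun e => by simpa using h.injective e
  have hpair : affDim ({x (Sum.inr 0), x (Sum.inr 1)} : Set V) = 1 :=
    affDim_pair fun e => by simpa using h.injective e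
  have h1 : ({x (Sum.inr 0), x (Sum.inr 1)} : Set V) ⊆
      ⋃₀ avoidingComplex (convexHull ℝ (Set.range x)) s := by
    rintro _ (rfl | rfl)
    exacts [hmem 0, hmem 1]
  have h2 : ⋃₀ avoidingComplex (convexHull ℝ (Set.range x)) s ⊆
      convexHull ℝ {x (Sum.inr 0), x (Sum.inr 1)} := by
    refine Set.sUnion_subset ?_
    rintro F ⟨hF, hav⟩
    obtain ⟨J, hJ, rfl⟩ := h.exists_isCircuitFace hF
    refine convexHull_mono ?_
    rintro _ ⟨i | j, hi, rfl⟩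
    · refine absurd ?_ (hav i)
      exact subset_convexHull ℝ _ (hs i ▸ Set.mem_image_of_mem x hi)
    · fin_cases j <;> simp
  have h3 := affDim_mono h1
  have h4 := affDim_mono h2
  rw [affDim_convexHull] at h4
  omega

theorem isSpecialSimplex (h : IsTwoCircuit x g) (s : Affine.Simplex ℝ V m)
    (hs : ∀ i, s.points i = x (Sum.inl i))
    (hcomb : ∀ J, IsCircuitFace {i | 0 < g i} {i | g i < 0} J →
      circuitDim {i | 0 < g i} {i | g i < 0} J = m →
      (Finset.univ.filter fun i => Sum.inl i ∈ J).card = m) :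
    IsSpecialSimplex (convexHull ℝ (Set.range x)) s := by
  refine ⟨fun i => hs i ▸ h.mem_vertexSet _, ?_⟩
  rintro F ⟨hF, hd⟩
  obtain ⟨J, hJ, rfl⟩ := h.exists_isCircuitFace hF
  rw [h.affDim_eq, affDim_convexHull, h.affDim_image, add_sub_cancel_right] at hd
  refine Eq.trans ?_ (hcomb J hJ hd)
  rw [← Set.ncard_coe_finset]
  congr 1
  ext i
  simp [hs, (h.exists_level_of_isCircuitFace hJ).2]

end IsTwoCircuit

theorem IsTwoCircuit.fVector_one {x : Fin 2 ⊕ Fin 2 → V} {g : Fin 2 ⊕ Fin 2 → ℝ}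
    (h : IsTwoCircuit (m := 1) x g) : fVector (convexHull ℝ (Set.range x)) = [1, 4, 4, 1] := by
  rw [h.fVector_eq, h.filter_pos, h.filter_neg]
  exact (circuit_combinatorics_one _ h.two_le).1

theorem IsTwoCircuit.fVector_two {x : Fin 3 ⊕ Fin 2 → V} {g : Fin 3 ⊕ Fin 2 → ℝ}
    (h : IsTwoCircuit (m := 2) x g) : fVector (convexHull ℝ (Set.range x)) = [1, 5, 9, 6, 1] ∨
      fVector (convexHull ℝ (Set.range x)) = [1, 5, 8, 5, 1] := by
  rw [h.fVector_eq, h.filter_pos, h.filter_neg]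
  exact (circuit_combinatorics_two _ h.two_le).1

/-- A non-constant supporting functional is not maximal on a whole special simplex. -/
theorem IsSpecialSimplex.eq_of_level {m : ℕ} {s : Affine.Simplex ℝ V m}
    (hs : IsSpecialSimplex P s) (hP : IsPolytope P) {l : StrongDual ℝ V} {M : ℝ}
    (hl : ∀ y ∈ P, l y ≤ M) (hv : ∀ i, l (s.points i) = M) : ∀ y ∈ P, l y = M := by
  intro y hy
  by_contra hne
  obtain ⟨F, hF, -, hF'⟩ :=
    hP.exists_facet_of_level_ne hl ⟨_, vertexSet_subset P (hs.1 0), hv 0⟩ hy hne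
  have h1 := hs.2 F hF
  have h2 : {i | s.points i ∈ F} = Set.univ := by
    ext i
    simp [hF' _ (vertexSet_subset P (hs.1 i)) (hv i)]
  rw [h2, Set.ncard_univ] at h1
  simp at h1

theorem IsSpecialSimplex.mem_of_ne {m : ℕ} {s : Affine.Simplex ℝ V m}
    (hs : IsSpecialSimplex P s) {F : Set V} (hF : F ∈ facets P) {i : Fin (m + 1)}
    (hi : s.points i ∉ F) {j : Fin (m + 1)} (hj : j ≠ i) : s.points j ∈ F := by
  by_contra hjF
  have h1 := hs.2 F hF
  have h2 : {i | s.points i ∈ F} ⊆ ((Finset.univ.erase i).erase j : Finset (Fin (m + 1))) := by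
    intro k hk
    have hk : s.points k ∈ F := hk
    simp only [Finset.coe_erase, Finset.coe_univ, Set.mem_sdiff, Set.mem_univ, true_and,
      Set.mem_singleton_iff]
    exact ⟨fun e => hi (e ▸ hk), fun e => hjF (e ▸ hk)⟩
  have h3 := Set.ncard_le_ncard h2
  rw [Set.ncard_coe_finset, Finset.card_erase_of_mem (by simp [hj]),
    Finset.card_erase_of_mem (by simp)] at h3
  simp at h3
  have : j.val ≠ i.val := fun e => hj (Fin.ext e)
  omega

/-- The part of `P` above a special simplex of codimension one is a pyramid over the simplex. -/
theorem IsSpecialSimplex.exists_coeffs {m : ℕ} {s : Affine.Simplex ℝ V m}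
    (hs : IsSpecialSimplex P s) (hP : IsPolytope P) (hd : affDim P = m + 1)
    {h : StrongDual ℝ V} {m₀ : ℝ} (hv : ∀ i, h (s.points i) = m₀) {z : V} (hz : z ∈ P)
    (hmax : ∀ y ∈ P, h y ≤ h z) (hlt : m₀ < h z) {y : V} (hy : y ∈ P) (hym : m₀ ≤ h y) :
    ∃ (c : Fin (m + 1) → ℝ) (d : ℝ), (∀ i, 0 ≤ c i) ∧ 0 ≤ d ∧ ∑ i, c i + d = 1 ∧
      y = ∑ i, c i • s.points i + d • z := by
  have hvP : ∀ i, s.points i ∈ P := fun i => vertexSet_subset P (hs.1 i)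
  have hvd : affDim (Set.range s.points) = m := by
    rw [affDim_of_nonempty (Set.range_nonempty _), s.independent.finrank_vectorSpan (Fintype.card_fin _)]
  have hzn : z ∉ affineSpan ℝ (Set.range s.points) := fun hz => hlt.ne'
    (map_eq_of_mem_affineSpan (by rintro _ ⟨i, rfl⟩; exact hv i) hz)
  have hspan : affineSpan ℝ (insert z (Set.range s.points)) = affineSpan ℝ P := by
    refine affineSpan_eq_of_affDim_le (Set.insert_subset hz ?_) (Set.insert_nonempty _ _) ?_
    · rintro _ ⟨i, rfl⟩
      exact hvP i
    · rw [affDim_insert_of_notMem hzn, hvd, hd]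
  have hyv : y - s.points 0 ∈ vectorSpan ℝ (insert z (Set.range s.points)) := by
    refine sub_mem_vectorSpan (hspan ▸ subset_affineSpan ℝ P hy)
      (hspan ▸ subset_affineSpan ℝ P (hvP 0))
  rw [vectorSpan_insert_eq_sup (Set.mem_range_self (0 : Fin (m + 1)))] at hyv
  obtain ⟨a, ha, b, hb, hab⟩ := Submodule.mem_sup.1 hyv
  obtain ⟨d, rfl⟩ := Submodule.mem_span_singleton.1 hb
  have hha : h a = 0 := map_eq_zero_of_mem_vectorSpan (M := m₀)
    (by rintro _ ⟨i, rfl⟩; exact hv i) ha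
  have hdeq : d * (h z - m₀) = h y - m₀ := by
    have := congrArg h hab
    simpa [hha, hv] using this
  -- `d` is the height of `y` over the simplex relative to that of `z`.
  have hd0 : 0 ≤ d := by
    by_contra! hneg
    have := mul_neg_of_neg_of_pos hneg (sub_pos.2 hlt)
    linarith
  obtain ⟨w, hw, hwa⟩ := eq_affineCombination_of_mem_affineSpan_of_fintype
    (add_mem_affineSpan (mem_affineSpan ℝ (Set.mem_range_self 0)) ha)
  rw [Finset.affineCombination_eq_linear_combination _ _ _ hw] at hwa
  -- `w` holds the barycentric coordinates of `s.points 0 + a`; since `y = s.points 0 + a + d • (z -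
  -- s.points 0)`, the weight `d` moves from vertex `0` to `z`.
  set c : Fin (m + 1) → ℝ := w - Pi.single 0 d with hc
  have hcsum : ∑ i, c i + d = 1 := by simp [hc, hw]
  have hyeq : y = ∑ i, c i • s.points i + d • z := by
    have h1 : ∑ i, c i • s.points i = ∑ i, w i • s.points i - d • s.points 0 := by
      simp [hc, sub_smul, Pi.single_apply]
    rw [h1, ← hwa]
    have := hab
    rw [smul_sub] at this
    rw [eq_add_of_sub_eq this.symm]
    abel
  refine ⟨c, d, fun i => ?_, hd0, hcsum, hyeq⟩
  by_contra! hci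
  -- With `c i < 0`, a facet through `z` missing vertex `i` would contain all other simplex
  -- vertices, and its functional would exceed `M` at `y`. So all facets through `z` contain vertex
  -- `i`, and the prolonged segment rises above `z`.
  obtain ⟨ε, hε, hext⟩ := hP.exists_extend hz (hvP i) (by
    intro F hF hzF
    by_contra hviF
    obtain ⟨l, M, hl, rfl⟩ := exists_level_of_mem_faceComplex hF.1 ⟨z, hzF⟩
    have hne : l (s.points i) < M :=
      lt_of_le_of_ne (hl _ (hvP i)) fun e => hviF ⟨hvP i, e⟩
    have h1 : ∀ j, c j * l (s.points j) = c j * M + if j = i then c i * (l (s.points i) - M) else 0 := by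
      intro j
      split_ifs with hji
      · subst hji; ring
      · rw [(hs.mem_of_ne hF hviF hji).2]; ring
    have h2 : l y = ∑ j, c j * l (s.points j) + d * M := by
      conv_lhs => rw [hyeq]
      simp [hzF.2]
    simp only [h1, Finset.sum_add_distrib, ← Finset.sum_mul] at h2
    simp only [Finset.sum_ite_eq', Finset.mem_univ, if_true] at h2
    have h3 := hl y hy
    have h4 := mul_pos_of_neg_of_neg hci (sub_neg.2 hne)
    have h5 : (∑ j, c j) * M + d * M = M := by rw [← add_mul, hcsum, one_mul]
    linarith)
  have h1 := hmax _ hext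
  simp only [map_add, map_smul, map_sub, smul_eq_mul, hv] at h1
  have := mul_pos hε (sub_pos.2 hlt)
  linarith

theorem IsSpecialSimplex.exists_isTwoCircuit {m : ℕ} {s : Affine.Simplex ℝ V m}
    (hs : IsSpecialSimplex P s) (hP : IsPolytope P) (hd : affDim P = m + 1) :
    ∃ (x : Fin (m + 1) ⊕ Fin 2 → V) (g : Fin (m + 1) ⊕ Fin 2 → ℝ), IsTwoCircuit x g ∧
      P = convexHull ℝ (Set.range x) := by
  have hvP : ∀ i, s.points i ∈ P := fun i => vertexSet_subset P (hs.1 i)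
  have hvd : affDim (Set.range s.points) = m := by
    rw [affDim_of_nonempty (Set.range_nonempty _), s.independent.finrank_vectorSpan (Fintype.card_fin _)]
  obtain ⟨y₀, hy₀, hy₀n⟩ : ∃ y ∈ P, y ∉ affineSpan ℝ (Set.range s.points) := by
    by_contra! hn
    have := affDim_mono (show P ⊆ affineSpan ℝ (Set.range s.points) from hn)
    rw [affDim_affineSpan] at this
    omega
  obtain ⟨h, m₀, hv, hhy₀⟩ :=
    exists_strongDual_of_notMem_affineSpan (Set.range_nonempty s.points) hy₀n 1
  replace hv : ∀ i, h (s.points i) = m₀ := fun i => hv _ (mem_affineSpan ℝ ⟨i, rfl⟩)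
  obtain ⟨z, hz, hzmax⟩ := hP.exists_max ⟨y₀, hy₀⟩ h
  obtain ⟨w, hw, hwmin⟩ := hP.exists_max ⟨y₀, hy₀⟩ (-h)
  have hzP := vertexSet_subset P hz
  have hwP := vertexSet_subset P hw
  have hzlt : m₀ < h z := by
    have := hzmax y₀ hy₀
    linarith
  -- If nothing lay below the simplex, `-h` would be a nonconstant supporting functional maximal on
  -- all of it.
  have hwlt : -m₀ < (-h) w := by
    by_contra! hn
    have := hs.eq_of_level hP (l := -h) (M := -m₀) (fun y hy => (hwmin y hy).trans hn)
      (fun i => by simp [hv]) y₀ hy₀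
    simp at this
    linarith
  have hwlt' : h w < m₀ := by simpa using hwlt
  -- Chosen so that `p` is the point of the segment from `w` to `z` at the height of the simplex.
  set α := (m₀ - h w) / (h z - h w) with hα
  have hden : 0 < h z - h w := by linarith
  have hα0 : 0 < α := div_pos (by linarith) hden
  have hα1 : α < 1 := (div_lt_one hden).2 (by linarith)
  have hαeq : α * (h z - h w) = m₀ - h w := div_mul_cancel₀ _ hden.ne'
  set p := α • z + (1 - α) • w with hp
  have hpP : p ∈ P := hP.convex hzP hwP hα0.le (by linarith) (by ring)
  have hhp : h p = m₀ := by simp [hp]; linarith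
  obtain ⟨c, d, hc, -, hcd, hpc⟩ := hs.exists_coeffs hP hd hv hzP hzmax hzlt hpP hhp.ge
  -- `p` has the height of the simplex, so `z` gets no weight: the segment meets the simplex, and
  -- this gives the dependency.
  have hd0 : d = 0 := by
    have h1 := congrArg h hpc
    simp only [hhp, map_add, map_sum, map_smul, smul_eq_mul, hv, ← Finset.sum_mul] at h1
    have h2 : d * (h z - m₀) = 0 := by
      have : ∑ i, c i = 1 - d := by linarith
      rw [this] at h1
      linarith
    exact (mul_eq_zero.1 h2).resolve_right (by linarith)
  subst hd0
  simp only [add_zero, zero_smul] at hcd hpc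
  let x : Fin (m + 1) ⊕ Fin 2 → V := Sum.elim s.points ![z, w]
  let g : Fin (m + 1) ⊕ Fin 2 → ℝ := Sum.elim (-c) ![α, 1 - α]
  have hPx : P = convexHull ℝ (Set.range x) := by
    apply Set.Subset.antisymm
    · have hx0 : ∀ i, s.points i ∈ convexHull ℝ (Set.range x) := fun i =>
        subset_convexHull ℝ _ ⟨Sum.inl i, rfl⟩
      have key : ∀ u ∈ convexHull ℝ (Set.range x), ∀ y (c : Fin (m + 1) → ℝ) (d : ℝ),
          (∀ i, 0 ≤ c i) → 0 ≤ d → ∑ i, c i + d = 1 → y = ∑ i, c i • s.points i + d • u →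
          y ∈ convexHull ℝ (Set.range x) := by
        rintro u hu y c d hc hd hcd rfl
        have := (convex_convexHull ℝ (Set.range x)).sum_mem (t := Finset.univ)
          (w := fun o : Option (Fin (m + 1)) => o.elim d c)
          (z := fun o => o.elim u s.points)
          (by rintro (_ | i) -; exacts [hd, hc i])
          (by rw [Fintype.sum_option]; simp; linarith)
          (by rintro (_ | i) -; exacts [hu, hx0 i])
        rw [Fintype.sum_option] at this
        simpa [add_comm] using this
      intro y hy
      rcases le_total m₀ (h y) with hle | hle
      · obtain ⟨c, d, h1, h2, h3, h4⟩ := hs.exists_coeffs hP hd hv hzP hzmax hzlt hy hle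
        exact key z (subset_convexHull ℝ _ ⟨Sum.inr 0, rfl⟩) y c d h1 h2 h3 h4
      · obtain ⟨c, d, h1, h2, h3, h4⟩ := hs.exists_coeffs hP hd (h := -h) (m₀ := -m₀)
          (fun i => by simp [hv]) hwP hwmin hwlt hy (by simpa using hle)
        exact key w (subset_convexHull ℝ _ ⟨Sum.inr 1, rfl⟩) y c d h1 h2 h3 h4
    · refine convexHull_min ?_ hP.convex
      rintro _ ⟨i | j, rfl⟩
      · exact hvP i
      · fin_cases j
        exacts [hzP, hwP]
  have hgsum : ∑ i, g i = 0 := by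
    simp [g, Fintype.sum_sum_type, hcd]
  have hgx : ∑ i, g i • x i = 0 := by
    simp [g, x, Fintype.sum_sum_type, ← hpc, hp]
  have hx : affDim (Set.range x) = Fintype.card (Fin (m + 1) ⊕ Fin 2) - 2 := by
    rw [← affDim_convexHull, ← hPx, hd]
    simp
  obtain ⟨g', hg'⟩ := exists_isAffineCircuit inferInstance hx
  have hpos : ∀ j, 0 < g (Sum.inr j) := by
    intro j
    fin_cases j
    · exact hα0
    · exact sub_pos.2 hα1
  refine ⟨x, g, ⟨hg'.of_dependency hgsum hgx fun e => ?_, hpos, fun i => ?_, ?_⟩, hPx⟩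
  · have := hpos 0
    simp [e] at this
  · simpa [g] using hc i
  -- A single nonzero coordinate would make `p` a vertex of the simplex, hence a vertex of `P`
  -- inside the segment between `z` and `w`.
  · by_contra! hcard
    obtain ⟨i, -, hi⟩ : ∃ i ∈ Finset.univ, 0 < c i :=
      Finset.exists_lt_of_sum_lt (by simp [hcd])
    have hother : ∀ j, j ≠ i → c j = 0 := fun j hj => by
      by_contra hcj
      have hcj' : 0 < c j := lt_of_le_of_ne (hc j) (Ne.symm hcj)
      have : 1 < (Finset.univ.filter fun i => g (Sum.inl i) < 0).card :=
        Finset.one_lt_card.2 ⟨j, by simpa [g] using hcj', i, by simpa [g] using hi, hj⟩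
      omega
    rw [Finset.sum_eq_single i (fun j _ hj => hother j hj) (by simp)] at hcd
    rw [Finset.sum_eq_single i (fun j _ hj => by simp [hother j hj]) (by simp), hcd,
      one_smul] at hpc
    have := eq_of_mem_vertexSet_of_combo (hs.1 i) hzP hwP hα0 (by linarith : 0 ≤ 1 - α) (by ring)
      (hpc ▸ hp)
    rw [this, hv] at hzlt
    exact lt_irrefl _ hzlt

/-- In an affine dependency among vertices at least two coefficients are positive. -/
theorem two_le_card_pos {ι : Type*} [Fintype ι] [DecidableEq ι] {x : ι → V} {g : ι → ℝ}
    (h : IsAffineCircuit x g) (hx : Function.Injective x)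
    (hv : ∀ i, x i ∈ vertexSet P) : 2 ≤ (Finset.univ.filter fun i => 0 < g i).card := by
  by_contra! hcard
  obtain ⟨i, hi⟩ := h.exists_pos
  obtain ⟨j, hj⟩ := h.exists_neg
  have hother : ∀ k, k ≠ i → g k ≤ 0 := fun k hk => by
    by_contra! hgk
    have : 1 < (Finset.univ.filter fun i => 0 < g i).card :=
      Finset.one_lt_card.2 ⟨k, by simpa using hgk, i, by simpa using hi, hk⟩
    omega
  obtain ⟨-, l, hl⟩ := exists_level_of_mem_vertexSet (hv i)
  have hl' : ∀ k, k ≠ i → 0 < l (x i) - l (x k) := fun k hk =>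
    sub_pos.2 (hl _ (vertexSet_subset P (hv k)) fun e => hk (hx e))
  -- If `i` is the only positive index, a functional with unique maximum at `x i` makes every term
  -- of this sum nonpositive and the term at `j` negative.
  have hsum : ∑ k, g k * (l (x i) - l (x k)) = 0 := by
    have h1 : ∑ i, g i * l (x i) = l (∑ i, g i • x i) := by simp
    rw [h.sum_smul_eq, map_zero] at h1
    simp only [mul_sub, Finset.sum_sub_distrib, h1, ← Finset.sum_mul, h.sum_eq]
    simp
  refine hsum.not_lt (Finset.sum_neg' (fun k _ => ?_) ⟨j, Finset.mem_univ j,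
    mul_neg_of_neg_of_pos hj (hl' j fun e => ?_)⟩)
  · by_cases hk : k = i
    · simp [hk]
    · exact mul_nonpos_of_nonpos_of_nonneg (hother k hk) (hl' k hk).le
  · rw [e] at hj
    exact lt_asymm hi hj

/-- Both signs of the dependency occur at least twice among `m + 3 ≤ 5` vertices, so after a
possible change of sign exactly two coefficients are positive. The bound on `m` serves only this
count. -/
theorem IsPolytope.exists_isTwoCircuit {m : ℕ} (hP : IsPolytope P) (hd : affDim P = m + 1)
    (hcard : (vertexSet P).ncard = m + 3) (hm : m ≤ 2) :
    ∃ (x : Fin (m + 1) ⊕ Fin 2 → V) (g : Fin (m + 1) ⊕ Fin 2 → ℝ), IsTwoCircuit x g ∧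
      P = convexHull ℝ (Set.range x) := by
  classical
  have : Fintype (vertexSet P) := hP.finite_vertexSet.fintype
  have hcard' : Fintype.card (vertexSet P) = m + 3 := by
    rw [← hcard, Set.ncard_eq_toFinset_card', Set.toFinset_card]
  set x : vertexSet P → V := Subtype.val with hx
  have hinj : Function.Injective x := Subtype.val_injective
  have hrange : Set.range x = vertexSet P := Subtype.range_val
  have hne : Nonempty (vertexSet P) := Fintype.card_pos_iff.1 (by omega)
  obtain ⟨g₀, hg₀⟩ := exists_isAffineCircuit (x := x) hne
    (by rw [hrange, hP.affDim_vertexSet, hd, hcard']; push_cast; ring)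
  obtain ⟨g, hg, hg2⟩ : ∃ g, IsAffineCircuit x g ∧
      (Finset.univ.filter fun i => 0 < g i).card = 2 := by
    have h1 := two_le_card_pos hg₀ hinj (fun i => i.2)
    have hg₁ := hg₀.smul (r := -1) (by norm_num)
    have h2 := two_le_card_pos hg₁ hinj (fun i => i.2)
    have h3 : Disjoint (Finset.univ.filter fun i => 0 < g₀ i)
        (Finset.univ.filter fun i => 0 < ((-1 : ℝ) • g₀) i) := by
      rw [Finset.disjoint_filter]
      intro i _ hi
      simp only [Pi.smul_apply, smul_eq_mul, neg_mul, one_mul, not_lt]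
      linarith
    have h4 := Finset.card_le_univ ((Finset.univ.filter fun i => 0 < g₀ i) ∪
      (Finset.univ.filter fun i => 0 < ((-1 : ℝ) • g₀) i))
    rw [Finset.card_union_of_disjoint h3, hcard'] at h4
    by_cases h5 : (Finset.univ.filter fun i => 0 < g₀ i).card = 2
    · exact ⟨g₀, hg₀, h5⟩
    · exact ⟨_, hg₁, by omega⟩
  have e1 : Fintype.card {i // 0 < g i} = 2 := by rw [Fintype.card_subtype, hg2]
  have e2 : Fintype.card {i // ¬ 0 < g i} = m + 1 := by
    rw [Fintype.card_subtype_compl, e1, hcard']; omega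
  let e : Fin (m + 1) ⊕ Fin 2 ≃ vertexSet P :=
    ((Equiv.sumComm _ _).trans (Equiv.sumCongr (Fintype.equivFinOfCardEq e1).symm
      (Fintype.equivFinOfCardEq e2).symm)).trans (Equiv.sumCompl fun i => 0 < g i)
  have hinl : ∀ i, ¬ 0 < g (e (Sum.inl i)) := fun i =>
    ((Fintype.equivFinOfCardEq e2).symm i).2
  have hinr : ∀ j, 0 < g (e (Sum.inr j)) := fun j =>
    ((Fintype.equivFinOfCardEq e1).symm j).2
  have hneg := two_le_card_pos (hg.smul (r := -1) (by norm_num)) hinj (fun i => i.2)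
  refine ⟨x ∘ e, g ∘ e, ⟨⟨?_, ?_, ?_, ?_⟩, hinr, fun i => not_lt.1 (hinl i), ?_⟩, ?_⟩
  · exact (Equiv.sum_comp e g).trans hg.sum_eq
  · exact (Equiv.sum_comp e fun i => g i • x i).trans hg.sum_smul_eq
  · intro h
    have := hinr 0
    rw [show g (e (Sum.inr 0)) = (g ∘ e) (Sum.inr 0) from rfl, h] at this
    exact lt_irrefl _ this
  · intro c hc hc'
    obtain ⟨r, hr⟩ := hg.unique (c ∘ e.symm) ((Equiv.sum_comp e.symm c).trans hc) (by
      rw [← Equiv.sum_comp e]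
      simpa using hc')
    refine ⟨r, ?_⟩
    ext i
    have := congrFun hr (e i)
    simpa using this
  · refine hneg.trans (le_of_eq ?_)
    symm
    refine Finset.card_bij (fun i _ => e (Sum.inl i)) ?_ ?_ ?_
    · intro i hi
      simpa using hi
    · intro i _ j _ hij
      simpa using hij
    · intro k hk
      obtain ⟨i | j, rfl⟩ := e.surjective k
      · exact ⟨i, by simpa using hk, rfl⟩
      · have := hinr j
        simp at hk
        exact absurd hk this.not_gt
  · rw [Set.range_comp, e.surjective.range_eq, Set.image_univ, hrange, hP.convexHull_vertexSet]

/-- The `inl` points omit a point of the support of the dependency, so they are affinely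
independent. -/
theorem IsTwoCircuit.exists_simplex {m : ℕ} {x : Fin (m + 1) ⊕ Fin 2 → V}
    {g : Fin (m + 1) ⊕ Fin 2 → ℝ} (h : IsTwoCircuit x g) :
    ∃ s : Affine.Simplex ℝ V m, ∀ i, s.points i = x (Sum.inl i) := by
  refine ⟨⟨fun i => x (Sum.inl i), ?_⟩, fun i => rfl⟩
  rw [affineIndependent_iff_finrank_vectorSpan_eq ℝ _ (by simp : _ = m + 1)]
  have := h.affDim_image_of_notMem (J := Finset.univ.image Sum.inl) (i := Sum.inr 0) (by simp)
    (h.pos 0).ne'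
  rw [Finset.card_image_of_injective _ Sum.inl_injective] at this
  have e : x '' (Finset.univ.image Sum.inl : Finset (Fin (m + 1) ⊕ Fin 2)) =
      Set.range fun i => x (Sum.inl i) := by
    ext; simp
  rw [e, affDim_of_nonempty (Set.range_nonempty _)] at this
  simp at this
  exact_mod_cast this

theorem meekPolytopes_subset (n m : ℕ) : meekPolytopes V n m ⊆ specialPolytopes V n m :=
  fun _ ⟨h1, h2, s, h3, _⟩ => ⟨h1, h2, s, h3⟩

theorem specialPolytopes_two_one_subset :
    specialPolytopes V 2 1 ⊆ {P | IsPolytope P ∧ fVector P = [1, 4, 4, 1]} := by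
  rintro P ⟨hP, hd, s, hs⟩
  obtain ⟨x, g, h, rfl⟩ := hs.exists_isTwoCircuit hP hd
  exact ⟨hP, h.fVector_one⟩

theorem specialPolytopes_three_two_subset : specialPolytopes V 3 2 ⊆
    {P | IsPolytope P ∧ (fVector P = [1, 5, 9, 6, 1] ∨ fVector P = [1, 5, 8, 5, 1])} := by
  rintro P ⟨hP, hd, s, hs⟩
  obtain ⟨x, g, h, rfl⟩ := hs.exists_isTwoCircuit hP hd
  exact ⟨hP, h.fVector_two⟩

theorem subset_meekPolytopes_two_one :
    {P | IsPolytope P ∧ fVector P = [1, 4, 4, 1]} ⊆ meekPolytopes V 2 1 := by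
  rintro P ⟨hP, hf⟩
  have hd : affDim P = 2 := by
    have := affDim_add_two_of_fVector hf
    simp at this
    omega
  have hc := ncard_of_fVector hf (i := 1) (by simp)
  simp [ncard_faces_affDim_zero] at hc
  obtain ⟨x, g, h, rfl⟩ := hP.exists_isTwoCircuit (m := 1) hd hc (by norm_num)
  obtain ⟨s, hs⟩ := h.exists_simplex
  refine ⟨hP, hd, s, h.isSpecialSimplex s hs ?_, h.isMeek s hs⟩
  rw [h.filter_pos, h.filter_neg]
  exact (circuit_combinatorics_one _ h.two_le).2

theorem subset_meekPolytopes_three_two :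
    {P | IsPolytope P ∧ (fVector P = [1, 5, 9, 6, 1] ∨ fVector P = [1, 5, 8, 5, 1])} ⊆
      meekPolytopes V 3 2 := by
  rintro P ⟨hP, hf⟩
  have hd : affDim P = 3 := by
    rcases hf with hf | hf <;>
    · have := affDim_add_two_of_fVector hf
      simp at this
      omega
  have hc : (vertexSet P).ncard = 5 := by
    rcases hf with hf | hf <;>
    · have hc := ncard_of_fVector hf (i := 1) (by simp)
      simpa [ncard_faces_affDim_zero] using hc
  obtain ⟨x, g, h, rfl⟩ := hP.exists_isTwoCircuit (m := 2) hd hc (by norm_num)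
  obtain ⟨s, hs⟩ := h.exists_simplex
  refine ⟨hP, hd, s, h.isSpecialSimplex s hs ?_, h.isMeek s hs⟩
  rw [h.filter_pos, h.filter_neg]
  exact (circuit_combinatorics_two _ h.two_le).2

end SpecialSimplex

/-! ### Polygons: vertices and edges -/

section Polygon

variable {V : Type*} [NormedAddCommGroup V] [NormedSpace ℝ V] [FiniteDimensional ℝ V] {P Q : Set V}

theorem eq_of_mem_faceComplex_of_affDim_le {F : Set V} (hF : F ∈ faceComplex P)
    (hd : affDim P ≤ affDim F) : F = P := by
  have hFP := subset_of_mem_faceComplex hF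
  by_cases hne : F.Nonempty
  · have hspan := affineSpan_eq_of_affDim_le hFP hne hd
    obtain ⟨l, M, hl, rfl⟩ := exists_level_of_mem_faceComplex hF hne
    refine hFP.antisymm fun y hy => ⟨hy, ?_⟩
    exact map_eq_of_mem_affineSpan (fun z hz => hz.2) (hspan ▸ subset_affineSpan ℝ P hy)
  · rw [Set.not_nonempty_iff_eq_empty.1 hne, affDim_empty] at hd
    by_contra hFP'
    obtain ⟨y, hy⟩ : P.Nonempty := by
      rw [Set.nonempty_iff_ne_empty]
      exact fun e => hFP' (by rw [e, Set.not_nonempty_iff_eq_empty.1 hne])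
    have := affDim_nonneg_iff.2 ⟨y, hy⟩
    omega

theorem affDim_eq_neg_one_iff {S : Set V} : affDim S = -1 ↔ S = ∅ := by
  refine ⟨fun h => ?_, fun h => h ▸ affDim_empty⟩
  by_contra hne
  have := affDim_nonneg_iff.2 (Set.nonempty_iff_ne_empty.2 hne)
  omega

theorem ncard_faces_affDim_neg_one (P : Set V) :
    {F | F ∈ faceComplex P ∧ affDim F = -1}.ncard = 1 := by
  refine Set.ncard_eq_one.2 ⟨∅, ?_⟩
  ext F
  simp only [Set.mem_ofPred_eq, affDim_eq_neg_one_iff, Set.mem_singleton_iff]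
  exact ⟨fun h => h.2, fun h => ⟨h ▸ empty_mem_faceComplex P, h⟩⟩

theorem ncard_faces_affDim_self (P : Set V) :
    {F | F ∈ faceComplex P ∧ affDim F = affDim P}.ncard = 1 := by
  refine Set.ncard_eq_one.2 ⟨P, ?_⟩
  ext F
  simp only [Set.mem_ofPred_eq, Set.mem_singleton_iff]
  exact ⟨fun h => eq_of_mem_faceComplex_of_affDim_le h.1 h.2.ge,
    fun h => ⟨h ▸ self_mem_faceComplex P, h ▸ rfl⟩⟩

/-- An edge contains exactly two vertices. -/
theorem IsPolytope.ncard_edge_inter_vertexSet (hP : IsPolytope P) {E : Set V}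
    (hE : E ∈ faceComplex P) (hd : affDim E = 1) : (E ∩ vertexSet P).ncard = 2 := by
  have hfin : (E ∩ vertexSet P).Finite := hP.finite_vertexSet.inter_of_right E
  have hd' : affDim (E ∩ vertexSet P) = 1 := by
    rw [← affDim_convexHull, ← hP.face_eq_convexHull hE, hd]
  apply le_antisymm
  · by_contra! h3
    obtain ⟨x, hx, y, hy, z, hz, hxy, hxz, hyz⟩ := (Set.two_lt_ncard hfin).1 h3
    -- Of three collinear points one lies between the other two, which a vertex cannot do.
    have hcol : Collinear ℝ ({x, y, z} : Set V) := by
      rw [collinear_iff_finrank_le_one]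
      have h1 := affDim_mono (show ({x, y, z} : Set V) ⊆ E ∩ vertexSet P by
        rintro _ (rfl | rfl | rfl) <;> assumption)
      rw [hd', affDim_of_nonempty ⟨x, by simp⟩] at h1
      exact_mod_cast h1
    have key : ∀ {x y z : V}, x ∈ vertexSet P → y ∈ vertexSet P → z ∈ vertexSet P → x ≠ y →
        z ≠ y → Wbtw ℝ x y z → False := by
      intro x y z hx hy hz hxy hzy hw
      rw [← mem_segment_iff_wbtw, ← convexHull_pair] at hw
      refine notMem_convexHull_of_mem_vertexSet hy ?_ ?_ hw
      · rintro _ (rfl | rfl)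
        exacts [vertexSet_subset P hx, vertexSet_subset P hz]
      · simp [hxy.symm, hzy.symm]
    rcases hcol.wbtw_or_wbtw_or_wbtw with h | h | h
    · exact key hx.2 hy.2 hz.2 hxy hyz.symm h
    · exact key hy.2 hz.2 hx.2 hyz hxz h
    · exact key hz.2 hx.2 hy.2 hxz.symm hxy.symm h
  · have h1 := affDim_finset_le hfin.toFinset
    rw [Set.Finite.coe_toFinset, hd', ← Set.ncard_eq_toFinset_card _ hfin] at h1
    omega

theorem IsPolytope.eq_of_edges_share (hP : IsPolytope P) {E F : Set V}
    (hE : E ∈ faceComplex P) (hEd : affDim E = 1) (hF : F ∈ faceComplex P) (hFd : affDim F = 1)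
    {u y : V} (hu : u ∈ vertexSet P) (hy : y ∈ vertexSet P) (huy : u ≠ y) (huE : u ∈ E)
    (hyE : y ∈ E) (huF : u ∈ F) (hyF : y ∈ F) : E = F := by
  have key : ∀ G ∈ faceComplex P, affDim G = 1 → u ∈ G → y ∈ G → G = convexHull ℝ {u, y} := by
    intro G hG hGd huG hyG
    have hfin : (G ∩ vertexSet P).Finite := hP.finite_vertexSet.inter_of_right G
    have : ({u, y} : Set V) = G ∩ vertexSet P := by
      refine Set.eq_of_subset_of_ncard_le ?_ ?_ hfin
      · rintro _ (rfl | rfl)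
        exacts [⟨huG, hu⟩, ⟨hyG, hy⟩]
      · rw [hP.ncard_edge_inter_vertexSet hG hGd, Set.ncard_pair huy]
    rw [this]
    exact hP.face_eq_convexHull hG
  rw [key E hE hEd huE hyE, key F hF hFd huF hyF]

theorem IsPolytope.exists_other_vertex (hP : IsPolytope P) {E : Set V}
    (hE : E ∈ faceComplex P) (hd : affDim E = 1) (u : V) :
    ∃ y ∈ vertexSet P, y ∈ E ∧ u ≠ y := by
  have h2 := hP.ncard_edge_inter_vertexSet hE hd
  obtain ⟨y, hy, hyu⟩ := Set.exists_ne_of_one_lt_ncard (by omega : 1 < (E ∩ vertexSet P).ncard) u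
  exact ⟨y, hy.2, hy.1, hyu.symm⟩

/-- A vertex of a polygon lies on exactly two edges. -/
theorem IsPolytope.ncard_edges_of_vertex (hP : IsPolytope P) (hd : affDim P = 2) {u : V}
    (hu : u ∈ vertexSet P) : {E | (E ∈ faceComplex P ∧ affDim E = 1) ∧ u ∈ E}.ncard = 2 := by
  have hfin : {E | (E ∈ faceComplex P ∧ affDim E = 1) ∧ u ∈ E}.Finite :=
    hP.finite_faceComplex.subset fun E hE => hE.1.1
  obtain ⟨huP, l, hl⟩ := exists_level_of_mem_vertexSet hu
  have hval : ∀ y ∈ P, l y ≤ l u := fun y hy => by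
    by_cases e : y = u
    · rw [e]
    · exact (hl y hy e).le
  have hex : ∀ y ∈ P, y ≠ u → ∃ E, (E ∈ faceComplex P ∧ affDim E = 1) ∧ u ∈ E ∧ y ∉ E := by
    intro y hy hyu
    obtain ⟨E, hE, hyE, hE'⟩ := hP.exists_facet_of_level_ne hval ⟨u, huP, rfl⟩ hy (hl y hy hyu).ne
    exact ⟨E, ⟨hE.1, by rw [hE.2, hd]; rfl⟩, hE' u huP rfl, hyE⟩
  apply le_antisymm
  · by_contra! h3
    obtain ⟨E₁, ⟨h₁, hu₁⟩, E₂, ⟨h₂, hu₂⟩, E₃, ⟨h₃, hu₃⟩, h12, h13, h23⟩ :=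
      (Set.two_lt_ncard hfin).1 h3
    -- The functional of each edge vanishes on its own direction from `u` and is negative on the
    -- directions of the other edges at `u`.
    have hfun : ∀ E : Set V, (E ∈ faceComplex P ∧ affDim E = 1) → u ∈ E →
        ∃ k : StrongDual ℝ V, ∃ y ∈ vertexSet P, u ≠ y ∧ y ∈ E ∧ k (y - u) = 0 ∧
          ∀ E', (E' ∈ faceComplex P ∧ affDim E' = 1) → u ∈ E' → E' ≠ E →
            ∀ z ∈ vertexSet P, u ≠ z → z ∈ E' → k (z - u) < 0 := by
      intro E hE huE
      obtain ⟨y, hy, hyE, huy⟩ := hP.exists_other_vertex hE.1 hE.2 u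
      obtain ⟨k, M, hk, hEk⟩ := exists_level_of_mem_faceComplex hE.1 ⟨u, huE⟩
      refine ⟨k, y, hy, huy, hyE, ?_, ?_⟩
      · rw [hEk] at hyE huE
        rw [map_sub, hyE.2, huE.2, sub_self]
      · intro E' hE' huE' hne z hz huz hzE'
        have hzE : z ∉ E := fun hzE =>
          hne (hP.eq_of_edges_share hE'.1 hE'.2 hE.1 hE.2 hu hz huz huE' hzE' huE hzE)
        rw [hEk] at hzE huE
        have := lt_of_le_of_ne (hk z (vertexSet_subset P hz))
          fun e => hzE ⟨vertexSet_subset P hz, e⟩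
        rw [map_sub, huE.2]
        linarith
    obtain ⟨k₁, y₁, hy₁, huy₁, hyE₁, hk₁, hk₁'⟩ := hfun E₁ h₁ hu₁
    obtain ⟨k₂, y₂, hy₂, huy₂, hyE₂, hk₂, hk₂'⟩ := hfun E₂ h₂ hu₂
    obtain ⟨k₃, y₃, hy₃, huy₃, hyE₃, hk₃, hk₃'⟩ := hfun E₃ h₃ hu₃
    have hmem : ∀ y ∈ vertexSet P, y - u ∈ vectorSpan ℝ P := fun y hy =>
      vsub_mem_vectorSpan ℝ (vertexSet_subset P hy) huP
    have hdep : ¬ LinearIndependent ℝ ![y₁ - u, y₂ - u, y₃ - u] := by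
      intro hli
      have h1 := finrank_span_eq_card hli
      have h2 : Submodule.span ℝ (Set.range ![y₁ - u, y₂ - u, y₃ - u]) ≤ vectorSpan ℝ P := by
        refine Submodule.span_le.2 ?_
        rintro _ ⟨i, rfl⟩
        fin_cases i
        exacts [hmem y₁ hy₁, hmem y₂ hy₂, hmem y₃ hy₃]
      have h3 := Submodule.finrank_mono h2
      rw [affDim_of_nonempty ⟨u, huP⟩] at hd
      simp at h1
      omega
    obtain ⟨c, hc, i, hi⟩ := Fintype.not_linearIndependent_iff.1 hdep
    simp only [Fin.sum_univ_three, Matrix.cons_val_zero, Matrix.cons_val_one,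
      Matrix.cons_val] at hc
    have e₁ := congrArg k₁ hc
    have e₂ := congrArg k₂ hc
    have e₃ := congrArg k₃ hc
    simp only [map_add, map_smul, smul_eq_mul, map_zero, hk₁, hk₂, hk₃, mul_zero, zero_add,
      add_zero] at e₁ e₂ e₃
    have a₁₂ := hk₁' E₂ h₂ hu₂ h12.symm y₂ hy₂ huy₂ hyE₂
    have a₁₃ := hk₁' E₃ h₃ hu₃ h13.symm y₃ hy₃ huy₃ hyE₃
    have a₂₁ := hk₂' E₁ h₁ hu₁ h12 y₁ hy₁ huy₁ hyE₁
    have a₂₃ := hk₂' E₃ h₃ hu₃ h23.symm y₃ hy₃ huy₃ hyE₃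
    have a₃₁ := hk₃' E₁ h₁ hu₁ h13 y₁ hy₁ huy₁ hyE₁
    have a₃₂ := hk₃' E₂ h₂ hu₂ h23 y₂ hy₂ huy₂ hyE₂
    -- Three directions in a plane are dependent. Each functional forces the other two coefficients
    -- to have opposite signs or both vanish, which is impossible for three numbers not all zero.
    have hneg : ∀ {a b s t : ℝ}, a * s + b * t = 0 → s < 0 → t < 0 → (0 < a → b < 0) ∧
        (a < 0 → 0 < b) ∧ (a = 0 → b = 0) := by
      intro a b s t h hs ht
      refine ⟨fun ha => ?_, fun ha => ?_, fun ha => ?_⟩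
      · by_contra! hb
        linarith [mul_neg_of_pos_of_neg ha hs, mul_nonpos_of_nonneg_of_nonpos hb ht.le]
      · by_contra! hb
        linarith [mul_pos_of_neg_of_neg ha hs, mul_nonneg_of_nonpos_of_nonpos hb ht.le]
      · rw [ha, zero_mul, zero_add] at h
        exact (mul_eq_zero.1 h).resolve_right ht.ne
    have r₁ := hneg e₁ a₁₂ a₁₃
    have r₂ := hneg e₂ a₂₁ a₂₃
    have r₃ := hneg e₃ a₃₁ a₃₂
    rcases lt_trichotomy (c 0) 0 with h | h | h
    · exact lt_asymm (r₁.1 (r₃.2.1 h)) (r₂.2.1 h)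
    · have h1 := r₃.2.2 h
      have h2 := r₂.2.2 h
      fin_cases i
      exacts [hi h, hi h1, hi h2]
    · exact lt_asymm (r₁.2.1 (r₃.1 h)) (r₂.1 h)
  -- One edge at `u` exists; a second is found by avoiding the other vertex of the first.
  · obtain ⟨y, hy, hyu⟩ : ∃ y ∈ P, y ≠ u := by
      by_contra! h
      have := affDim_mono (show P ⊆ {u} from h)
      rw [affDim_singleton, hd] at this
      omega
    obtain ⟨E₁, hE₁, hu₁, -⟩ := hex y hy hyu
    obtain ⟨z, hz, hzE, hzu⟩ := hP.exists_other_vertex hE₁.1 hE₁.2 u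
    obtain ⟨E₂, hE₂, hu₂, hzE₂⟩ := hex z (vertexSet_subset P hz) hzu.symm
    have : 1 < {E | (E ∈ faceComplex P ∧ affDim E = 1) ∧ u ∈ E}.ncard :=
      (Set.one_lt_ncard hfin).2 ⟨E₁, ⟨hE₁, hu₁⟩, E₂, ⟨hE₂, hu₂⟩, fun e => hzE₂ (e ▸ hzE)⟩
    exact this

/-- Vertices and edges are equinumerous by double counting incidences: two edges at each vertex, two
vertices on each edge. -/
theorem IsPolytope.fVector_polygon (hP : IsPolytope P) (hd : affDim P = 2) :
    3 ≤ (vertexSet P).ncard ∧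
      fVector P = [1, (vertexSet P).ncard, (vertexSet P).ncard, 1] := by
  classical
  have hfin : {E | E ∈ faceComplex P ∧ affDim E = 1}.Finite :=
    hP.finite_faceComplex.subset fun E hE => hE.1
  have hedges : {E | E ∈ faceComplex P ∧ affDim E = 1}.ncard = (vertexSet P).ncard := by
    have := Finset.card_mul_eq_card_mul (s := hP.finite_vertexSet.toFinset) (t := hfin.toFinset)
      (m := 2) (n := 2) (fun u E => u ∈ E) (fun u hu => by
        rw [← hP.ncard_edges_of_vertex hd ((Set.Finite.mem_toFinset _).1 hu),
          ← Set.ncard_coe_finset]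
        congr 1
        ext E
        simp [Finset.bipartiteAbove]) (fun E hE => by
        have hE := (Set.Finite.mem_toFinset _).1 hE
        rw [← hP.ncard_edge_inter_vertexSet hE.1 hE.2, ← Set.ncard_coe_finset]
        congr 1
        ext u
        simp [Finset.bipartiteBelow, and_comm])
    rw [Set.ncard_eq_toFinset_card _ hP.finite_vertexSet, Set.ncard_eq_toFinset_card _ hfin]
    omega
  constructor
  · have h1 := affDim_finset_le hP.finite_vertexSet.toFinset
    rw [Set.Finite.coe_toFinset, hP.affDim_vertexSet, hd,
      ← Set.ncard_eq_toFinset_card _ hP.finite_vertexSet] at h1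
    omega
  · have h0 := ncard_faces_affDim_neg_one P
    have h1 := ncard_faces_affDim_zero P
    have h3 := ncard_faces_affDim_self P
    rw [hd] at h3
    rw [fVector_eq_map, hd, show ((2 : ℤ) + 2).toNat = 4 from rfl]
    simp [List.range_succ, h0, h1, h3, hedges]

end Polygon

/-! ### Faces of bipyramids and meek 3-polytopes with a special edge -/

section Bipyramid

variable {V : Type*} [NormedAddCommGroup V] [NormedSpace ℝ V] [FiniteDimensional ℝ V] {P Q : Set V}

/-- The apices `v`, `w` of a bipyramid over `Q`, with the point `a • v + b • w` in the relative
interior of `Q`. -/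
structure AreApices (Q : Set V) (v w : V) (a b : ℝ) : Prop where
  left_notMem : v ∉ affineSpan ℝ Q
  right_notMem : w ∉ affineSpan ℝ Q
  left_pos : 0 < a
  right_pos : 0 < b
  add_eq : a + b = 1
  mem : a • v + b • w ∈ intrinsicInterior ℝ Q

theorem IsBipyramidOver.exists_areApices (h : IsBipyramidOver P Q) :
    ∃ v w a b, AreApices Q v w a b ∧ P = convexHull ℝ (Q ∪ {v, w}) := by
  obtain ⟨v, w, hv, hw, ⟨p, ⟨a, b, ha, hb, hab, rfl⟩, hp⟩, hP⟩ := h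
  exact ⟨v, w, a, b, ⟨hv, hw, ha, hb, hab, hp⟩, hP⟩

/-- The cone over a face. -/
def coneOver (v : V) (G : Set V) : Set V := convexHull ℝ (insert v G)

/-- Faces, including the empty one, as level sets. -/
theorem exists_level_of_face {G : Set V} (hG : G ∈ faceComplex Q) :
    ∃ (l : StrongDual ℝ V) (M : ℝ), (∀ y ∈ Q, l y ≤ M) ∧ G = {y | y ∈ Q ∧ l y = M} := by
  by_cases hne : G.Nonempty
  · exact exists_level_of_mem_faceComplex hG hne
  · refine ⟨0, 1, by simp, ?_⟩
    rw [Set.not_nonempty_iff_eq_empty.1 hne]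
    simp

theorem IsPolytope.convex_face (hQ : IsPolytope Q) {G : Set V} (hG : G ∈ faceComplex Q) :
    Convex ℝ G := by
  rw [hQ.face_eq_convexHull hG]
  exact convex_convexHull ℝ _

namespace AreApices

variable {v w : V} {a b : ℝ}

theorem symm (h : AreApices Q v w a b) : AreApices Q w v b a :=
  ⟨h.right_notMem, h.left_notMem, h.right_pos, h.left_pos, by rw [add_comm, h.add_eq], by
    rw [add_comm]; exact h.mem⟩

theorem mem_base (h : AreApices Q v w a b) : a • v + b • w ∈ Q := intrinsicInterior_subset h.mem

theorem left_notMem_base (h : AreApices Q v w a b) : v ∉ Q := fun hv =>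
  h.left_notMem (subset_affineSpan ℝ Q hv)

theorem ne (h : AreApices Q v w a b) : v ≠ w := by
  rintro rfl
  have := h.mem_base
  rw [← add_smul, h.add_eq, one_smul] at this
  exact h.left_notMem_base this

theorem isPolytope (hQ : IsPolytope Q) : IsPolytope (convexHull ℝ (Q ∪ {v, w})) := by
  have e : convexHull ℝ (Q ∪ {v, w}) = convexHull ℝ (vertexSet Q ∪ {v, w}) := by
    conv_lhs => rw [← hQ.convexHull_vertexSet]
    rw [convexHull_convexHull_union_left]
  rw [e]
  exact isPolytope_convexHull (hQ.finite_vertexSet.union (Set.toFinite _))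

theorem affDim_eq (h : AreApices Q v w a b) :
    affDim (convexHull ℝ (Q ∪ {v, w})) = affDim Q + 1 := by
  have hw : w ∈ affineSpan ℝ (insert v Q) := by
    have hv := subset_affineSpan ℝ _ (Set.mem_insert v Q)
    have hp := subset_affineSpan ℝ _ (Set.mem_insert_of_mem v h.mem_base)
    have := add_mem_affineSpan hv (Submodule.smul_mem _ b⁻¹ (sub_mem_vectorSpan hp hv))
    convert this
    have e : a • v + b • w - v = b • (w - v) := by
      rw [eq_sub_of_add_eq h.add_eq, sub_smul, one_smul, smul_sub]
      abel
    rw [e, smul_smul, inv_mul_cancel₀ h.right_pos.ne', one_smul]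
    abel
  rw [affDim_convexHull, ← affDim_insert_of_notMem h.left_notMem, ← affDim_insert_of_mem hw]
  congr 1
  ext y
  simp
  tauto

/-- Functionals on the base extend with prescribed value at the apex `v`. -/
theorem exists_extension (h : AreApices Q v w a b) (l : StrongDual ℝ V) (T : ℝ) :
    ∃ (L : StrongDual ℝ V) (C : ℝ), (∀ y ∈ Q, L y = l y + C) ∧ L v = T + C ∧
      a * T + b * (L w - C) = l (a • v + b • w) := by
  obtain ⟨k, m, hk, hkv⟩ := exists_strongDual_of_notMem_affineSpan ⟨_, h.mem_base⟩ h.left_notMem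
    (T - l v)
  have hk' : ∀ y ∈ Q, k y = m := fun y hy => hk y (subset_affineSpan ℝ Q hy)
  refine ⟨l + k, m, fun y hy => by simp [hk' y hy], by simp [hkv]; ring, ?_⟩
  have h1 := hk' _ h.mem_base
  simp only [map_add, map_smul, smul_eq_mul, hkv, add_apply] at h1 ⊢
  have h2 : b = 1 - a := by linarith [h.add_eq]
  subst h2
  linarith

theorem lt_of_ne (h : AreApices Q v w a b) {l : StrongDual ℝ V} {M : ℝ}
    (hl : ∀ y ∈ Q, l y ≤ M) (hne : {y | y ∈ Q ∧ l y = M} ≠ Q) : l (a • v + b • w) < M := by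
  refine lt_of_le_of_ne (hl _ h.mem_base) fun e => hne ?_
  have := eq_of_mem_intrinsicInterior h.mem hl e
  ext y
  exact ⟨fun hy => hy.1, fun hy => ⟨hy, this y hy⟩⟩

theorem valid {L : StrongDual ℝ V} {M : ℝ} (hQ : ∀ y ∈ Q, L y ≤ M) (hv : L v ≤ M) (hw : L w ≤ M) :
    ∀ y ∈ Q ∪ {v, w}, L y ≤ M := by
  rintro y (hy | rfl | rfl)
  exacts [hQ y hy, hv, hw]

theorem base_face (h : AreApices Q v w a b) (hQ : IsPolytope Q) {G : Set V}
    (hG : G ∈ faceComplex Q) (hGQ : G ≠ Q) : G ∈ faceComplex (convexHull ℝ (Q ∪ {v, w})) := by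
  obtain ⟨l, M, hl, rfl⟩ := exists_level_of_face hG
  have hlt := h.lt_of_ne hl hGQ
  -- Giving `v` the value of the crossing point forces the same value on `w`, so both apices lie
  -- strictly below the face.
  obtain ⟨L, C, hLQ, hLv, hLw⟩ := h.exists_extension l (l (a • v + b • w))
  have hLv' : L v < M + C := by linarith
  have hLw' : L w < M + C := by
    have h1 : b * (L w - C) = b * l (a • v + b • w) := by
      have : a = 1 - b := by linarith [h.add_eq]
      nth_rw 1 [this] at hLw
      linarith
    have := mul_left_cancel₀ h.right_pos.ne' h1
    linarith
  have hval := valid (fun y hy => by rw [hLQ y hy]; linarith [hl y hy]) hLv'.le hLw'.le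
  have key := level_mem_faceComplex (fun y hy => le_of_mem_convexHull hval hy)
  rw [convexHull_inter_level hval] at key
  have e : {x | x ∈ Q ∪ {v, w} ∧ L x = M + C} = {y | y ∈ Q ∧ l y = M} := by
    ext y
    constructor
    · rintro ⟨hy | rfl | rfl, hy'⟩
      · exact ⟨hy, by rw [hLQ y hy] at hy'; linarith⟩
      · exact absurd hy' hLv'.ne
      · exact absurd hy' hLw'.ne
    · rintro ⟨hy, hy'⟩
      exact ⟨Or.inl hy, by rw [hLQ y hy, hy']⟩
  rwa [e, (hQ.convex_face hG).convexHull_eq] at key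

theorem cone_face (h : AreApices Q v w a b) {G : Set V}
    (hG : G ∈ faceComplex Q) (hGQ : G ≠ Q) :
    coneOver v G ∈ faceComplex (convexHull ℝ (Q ∪ {v, w})) ∧ w ∉ coneOver v G ∧
      coneOver v G ∩ Q = G := by
  obtain ⟨l, M, hl, rfl⟩ := exists_level_of_face hG
  have hlt := h.lt_of_ne hl hGQ
  -- Raising `v` to the level of the face pushes `w` strictly below it, as the value at the crossing
  -- point is less than `M`.
  obtain ⟨L, C, hLQ, hLv, hLw⟩ := h.exists_extension l M
  have hLw' : L w < M + C := by
    by_contra! hge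
    have h1 := mul_le_mul_of_nonneg_left (by linarith : M ≤ L w - C) h.right_pos.le
    have h2 : a * M + b * M = M := by rw [← add_mul, h.add_eq, one_mul]
    linarith
  have hval := valid (fun y hy => by rw [hLQ y hy]; linarith [hl y hy]) hLv.le hLw'.le
  have key := level_mem_faceComplex (fun y hy => le_of_mem_convexHull hval hy)
  have key2 := convexHull_inter_level hval
  have e : {x | x ∈ Q ∪ {v, w} ∧ L x = M + C} = insert v {y | y ∈ Q ∧ l y = M} := by
    ext y
    constructor
    · rintro ⟨hy | rfl | rfl, hy'⟩
      · exact Or.inr ⟨hy, by rw [hLQ y hy] at hy'; linarith⟩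
      · exact Or.inl rfl
      · exact absurd hy' hLw'.ne
    · rintro (rfl | ⟨hy, hy'⟩)
      · exact ⟨Or.inr (Or.inl rfl), hLv⟩
      · exact ⟨Or.inl hy, by rw [hLQ y hy, hy']⟩
  rw [e] at key2
  have key3 : coneOver v {y | y ∈ Q ∧ l y = M} =
    {x | x ∈ convexHull ℝ (Q ∪ {v, w}) ∧ L x = M + C} := key2.symm
  rw [key3]
  refine ⟨key, fun hw => hLw'.ne hw.2, ?_⟩
  ext y
  constructor
  · rintro ⟨⟨-, hy⟩, hyQ⟩
    exact ⟨hyQ, by rw [hLQ y hyQ] at hy; linarith⟩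
  · rintro ⟨hyQ, hy⟩
    exact ⟨⟨subset_convexHull ℝ _ (Or.inl hyQ), by rw [hLQ y hyQ, hy]⟩, hyQ⟩

theorem swap_eq : convexHull ℝ (Q ∪ {w, v}) = convexHull ℝ (Q ∪ {v, w}) := by
  rw [Set.pair_comm]

/-- The proper faces of a bipyramid are the proper faces of the base and the cones over them. -/
theorem exists_face (h : AreApices Q v w a b) (hQ : IsPolytope Q) {F : Set V}
    (hF : F ∈ faceComplex (convexHull ℝ (Q ∪ {v, w}))) (hFP : F ≠ convexHull ℝ (Q ∪ {v, w})) :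
    ∃ G ∈ faceComplex Q, G ≠ Q ∧ (F = G ∨ F = coneOver v G ∨ F = coneOver w G) := by
  obtain ⟨L, M, hL, rfl⟩ := exists_level_of_face hF
  have hL' : ∀ y ∈ Q ∪ {v, w}, L y ≤ M := fun y hy => hL y (subset_convexHull ℝ _ hy)
  have hLQ : ∀ y ∈ Q, L y ≤ M := fun y hy => hL' y (Or.inl hy)
  have hLv := hL' v (by simp)
  have hLw := hL' w (by simp)
  have hp : L (a • v + b • w) = a * L v + b * L w := by simp
  have hM : a * M + b * M = M := by rw [← add_mul, h.add_eq, one_mul]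
  -- A functional maximal at the crossing point is constant on `Q` and at both apices, and then the
  -- face is the whole bipyramid.
  have hnot : L (a • v + b • w) ≠ M := by
    intro e
    apply hFP
    have hall := eq_of_mem_intrinsicInterior h.mem hLQ e
    have h1 := mul_le_mul_of_nonneg_left hLv h.left_pos.le
    have h2 := mul_le_mul_of_nonneg_left hLw h.right_pos.le
    have hv : L v = M := mul_left_cancel₀ h.left_pos.ne' (by linarith)
    have hw : L w = M := mul_left_cancel₀ h.right_pos.ne' (by linarith)
    rw [convexHull_inter_level hL']
    congr 1
    ext y
    refine ⟨fun hy => hy.1, fun hy => ⟨hy, ?_⟩⟩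
    rcases hy with hy | rfl | rfl
    exacts [hall y hy, hv, hw]
  refine ⟨{y | y ∈ Q ∧ L y = M}, level_mem_faceComplex hLQ, fun e => hnot ?_, ?_⟩
  · exact (e.superset h.mem_base).2
  · have hG := (hQ.convex_face (level_mem_faceComplex hLQ))
    rw [convexHull_inter_level hL']
    by_cases hv : L v = M
    · have hw : L w ≠ M := fun hw => hnot (by rw [hp, hv, hw, hM])
      right; left
      unfold coneOver
      congr 1
      ext y
      constructor
      · rintro ⟨hy | rfl | rfl, hy'⟩
        · exact Or.inr ⟨hy, hy'⟩
        · exact Or.inl rfl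
        · exact absurd hy' hw
      · rintro (rfl | ⟨hy, hy'⟩)
        · exact ⟨Or.inr (Or.inl rfl), hv⟩
        · exact ⟨Or.inl hy, hy'⟩
    · by_cases hw : L w = M
      · right; right
        unfold coneOver
        congr 1
        ext y
        constructor
        · rintro ⟨hy | rfl | rfl, hy'⟩
          · exact Or.inr ⟨hy, hy'⟩
          · exact absurd hy' hv
          · exact Or.inl rfl
        · rintro (rfl | ⟨hy, hy'⟩)
          · exact ⟨Or.inr (Or.inr rfl), hw⟩
          · exact ⟨Or.inl hy, hy'⟩
      · left
        conv_rhs => rw [← hG.convexHull_eq]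
        congr 1
        ext y
        constructor
        · rintro ⟨hy | rfl | rfl, hy'⟩
          · exact ⟨hy, hy'⟩
          · exact absurd hy' hv
          · exact absurd hy' hw
        · rintro ⟨hy, hy'⟩
          exact ⟨Or.inl hy, hy'⟩

theorem left_mem_cone (v : V) (G : Set V) : v ∈ coneOver v G :=
  subset_convexHull ℝ _ (Set.mem_insert v G)

theorem affDim_cone (h : AreApices Q v w a b) {G : Set V} (hG : G ⊆ Q) :
    affDim (coneOver v G) = affDim G + 1 := by
  rw [coneOver, affDim_convexHull, affDim_insert_of_notMem]
  exact fun hv => h.left_notMem (affineSpan_mono ℝ hG hv)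

theorem ne_base {G : Set V} (hd : affDim G < affDim Q) : G ≠ Q := fun e => by
  rw [e] at hd
  exact lt_irrefl _ hd

theorem affDim_lt {G : Set V} (hG : G ∈ faceComplex Q) (hGQ : G ≠ Q) : affDim G < affDim Q := by
  by_contra! hd
  exact hGQ (eq_of_mem_faceComplex_of_affDim_le hG hd)

/-- A cone determines its apex, since it misses the other one, and its base, as its intersection
with `Q`; so nothing is counted twice. The empty face is included: its cones are the apices. The
bound on `d` excludes the bipyramid itself. -/
theorem ncard_faces (h : AreApices Q v w a b) (hQ : IsPolytope Q) {d : ℤ} (hd : d ≤ affDim Q) :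
    {F | F ∈ faceComplex (convexHull ℝ (Q ∪ {v, w})) ∧ affDim F = d}.ncard =
      {G | (G ∈ faceComplex Q ∧ G ≠ Q) ∧ affDim G = d}.ncard +
      2 * {G | (G ∈ faceComplex Q ∧ G ≠ Q) ∧ affDim G = d - 1}.ncard := by
  set A := {G | (G ∈ faceComplex Q ∧ G ≠ Q) ∧ affDim G = d} with hA
  set B := {G | (G ∈ faceComplex Q ∧ G ≠ Q) ∧ affDim G = d - 1} with hB
  have hAf : A.Finite := hQ.finite_faceComplex.subset fun G hG => hG.1.1
  have hBf : B.Finite := hQ.finite_faceComplex.subset fun G hG => hG.1.1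
  have hsub : ∀ {G}, G ∈ faceComplex Q → G ⊆ Q := fun hG => subset_of_mem_faceComplex hG
  have hcv : ∀ G ∈ B, _ := fun G hG => h.cone_face hG.1.1 hG.1.2
  have hcw : ∀ G ∈ B, _ := fun G hG => h.symm.cone_face hG.1.1 hG.1.2
  have e : {F | F ∈ faceComplex (convexHull ℝ (Q ∪ {v, w})) ∧ affDim F = d} =
      A ∪ (coneOver v '' B ∪ coneOver w '' B) := by
    ext F
    constructor
    · rintro ⟨hF, hFd⟩
      have hFP : F ≠ convexHull ℝ (Q ∪ {v, w}) := by
        rintro rfl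
        rw [h.affDim_eq] at hFd
        omega
      obtain ⟨G, hG, hGQ, rfl | rfl | rfl⟩ := h.exists_face hQ hF hFP
      · exact Or.inl ⟨⟨hG, hGQ⟩, hFd⟩
      · rw [h.affDim_cone (hsub hG)] at hFd
        exact Or.inr (Or.inl ⟨G, ⟨⟨hG, hGQ⟩, by omega⟩, rfl⟩)
      · rw [h.symm.affDim_cone (hsub hG)] at hFd
        exact Or.inr (Or.inr ⟨G, ⟨⟨hG, hGQ⟩, by omega⟩, rfl⟩)
    · rintro (hF | ⟨G, hG, rfl⟩ | ⟨G, hG, rfl⟩)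
      · exact ⟨h.base_face hQ hF.1.1 hF.1.2, hF.2⟩
      · exact ⟨(hcv G hG).1, by rw [h.affDim_cone (hsub hG.1.1), hG.2]; ring⟩
      · exact ⟨swap_eq (Q := Q) (v := v) ▸ (hcw G hG).1, by
          rw [h.symm.affDim_cone (hsub hG.1.1), hG.2]; ring⟩
  have hinjv : Set.InjOn (coneOver v) B := fun G hG G' hG' hGG' => by
    rw [← (hcv G hG).2.2, ← (hcv G' hG').2.2, hGG']
  have hinjw : Set.InjOn (coneOver w) B := fun G hG G' hG' hGG' => by
    rw [← (hcw G hG).2.2, ← (hcw G' hG').2.2, hGG']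
  have hd1 : Disjoint (coneOver v '' B) (coneOver w '' B) := by
    rw [Set.disjoint_left]
    rintro _ ⟨G, hG, rfl⟩ ⟨G', hG', e⟩
    exact (hcv G hG).2.1 (e ▸ left_mem_cone w G')
  have hd2 : Disjoint A (coneOver v '' B ∪ coneOver w '' B) := by
    rw [Set.disjoint_left]
    rintro F hF (⟨G, hG, rfl⟩ | ⟨G, hG, rfl⟩)
    · exact h.left_notMem_base (hsub hF.1.1 (left_mem_cone v G))
    · exact h.symm.left_notMem_base (hsub hF.1.1 (left_mem_cone w G))
  rw [e, Set.ncard_union_eq hd2 hAf ((hBf.image _).union (hBf.image _)),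
    Set.ncard_union_eq hd1 (hBf.image _) (hBf.image _), hinjv.ncard_image, hinjw.ncard_image]
  ring

theorem fVector_bipyramid (h : AreApices Q v w a b) (hQ : IsPolytope Q) (hd : affDim Q = 2) :
    fVector (convexHull ℝ (Q ∪ {v, w})) =
      [1, (vertexSet Q).ncard + 2, 3 * (vertexSet Q).ncard, 2 * (vertexSet Q).ncard, 1] := by
  have hf := (hQ.fVector_polygon hd).2
  have hprop : ∀ d : ℤ, d < 2 → {G | (G ∈ faceComplex Q ∧ G ≠ Q) ∧ affDim G = d} =
      {G | G ∈ faceComplex Q ∧ affDim G = d} := by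
    intro d hd'
    ext G
    exact ⟨fun hG => ⟨hG.1.1, hG.2⟩, fun hG => ⟨⟨hG.1, ne_base (by rw [hG.2, hd]; exact hd')⟩, hG.2⟩⟩
  have htop : {G | (G ∈ faceComplex Q ∧ G ≠ Q) ∧ affDim G = 2} = ∅ := by
    refine Set.eq_empty_of_forall_notMem fun G hG => ?_
    have := affDim_lt hG.1.1 hG.1.2
    rw [hG.2, hd] at this
    exact lt_irrefl _ this
  have q0 := ncard_faces_affDim_neg_one Q
  have q1 := ncard_faces_affDim_zero Q
  have q2 := ncard_of_fVector hf (i := 2) (by simp)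
  simp only [Nat.cast_ofNat, List.getElem_cons_succ, List.getElem_cons_zero] at q2
  norm_num at q2
  have p0 := ncard_faces_affDim_neg_one (convexHull ℝ (Q ∪ {v, w}))
  have p1 := h.ncard_faces hQ (d := 0) (by omega)
  have p2 := h.ncard_faces hQ (d := 1) (by omega)
  have p3 := h.ncard_faces hQ (d := 2) (by omega)
  have p4 := ncard_faces_affDim_self (convexHull ℝ (Q ∪ {v, w}))
  have hP : affDim (convexHull ℝ (Q ∪ {v, w})) = 3 := by rw [h.affDim_eq, hd]; rfl
  rw [hP] at p4
  rw [hprop 0 (by norm_num), hprop (0 - 1) (by norm_num), zero_sub, q0, q1] at p1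
  rw [hprop 1 (by norm_num), hprop (1 - 1) (by norm_num), sub_self, q1, q2] at p2
  rw [htop, hprop (2 - 1) (by norm_num), show (2 : ℤ) - 1 = 1 by norm_num, q2,
    Set.ncard_empty] at p3
  rw [fVector_eq_map, hP, show ((3 : ℤ) + 2).toNat = 5 from rfl]
  generalize convexHull ℝ (Q ∪ {v, w}) = P at *
  simp [List.range_succ, p0]
  norm_num [p1, p2, p3]
  exact ⟨by ring, Set.ncard_eq_one.1 p4⟩

/-- Proper faces of `Q` have dimension at most one, so each facet is a cone and contains exactly one
apex. The faces avoiding both apices are proper faces of `Q`; they include its vertices and so span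
a plane. -/
theorem exists_special (h : AreApices Q v w a b) (hQ : IsPolytope Q) (hd : affDim Q = 2) :
    ∃ s : Affine.Simplex ℝ V 1, IsSpecialSimplex (convexHull ℝ (Q ∪ {v, w})) s ∧
      IsMeek (convexHull ℝ (Q ∪ {v, w})) s := by
  let s : Affine.Simplex ℝ V 1 := ⟨![v, w], affineIndependent_of_ne ℝ h.ne⟩
  have hQne : Q.Nonempty := ⟨_, h.mem_base⟩
  have hemp : (∅ : Set V) ≠ Q := hQne.ne_empty.symm
  have hvv : v ∈ vertexSet (convexHull ℝ (Q ∪ {v, w})) := by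
    have := (h.cone_face (empty_mem_faceComplex Q) hemp).1
    rwa [coneOver, insert_empty_eq, convexHull_singleton] at this
  have hwv : w ∈ vertexSet (convexHull ℝ (Q ∪ {v, w})) := by
    have := (h.symm.cone_face (empty_mem_faceComplex Q) hemp).1
    rwa [swap_eq, coneOver, insert_empty_eq, convexHull_singleton] at this
  have hsv : ∀ i, s.points i ∈ vertexSet (convexHull ℝ (Q ∪ {v, w})) := by
    intro i
    fin_cases i
    exacts [hvv, hwv]
  have hP : affDim (convexHull ℝ (Q ∪ {v, w})) = 3 := by rw [h.affDim_eq, hd]; rfl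
  refine ⟨s, ⟨hsv, ?_⟩, ?_⟩
  · rintro F ⟨hF, hFd⟩
    rw [hP] at hFd
    obtain ⟨G, hG, hGQ, rfl | rfl | rfl⟩ := h.exists_face hQ hF (fun e => by rw [e, hP] at hFd; omega)
    · have := affDim_lt hG hGQ
      omega
    · have h1 := (h.cone_face hG hGQ).2.1
      refine Set.ncard_eq_one.2 ⟨0, ?_⟩
      ext i
      fin_cases i
      · simpa [s] using left_mem_cone v G
      · simpa [s] using h1
    · have h1 := (h.symm.cone_face hG hGQ).2.1
      refine Set.ncard_eq_one.2 ⟨1, ?_⟩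
      ext i
      fin_cases i
      · simpa [s] using h1
      · simpa [s] using left_mem_cone w G
  · have hrange : Set.range s.points ⊆ convexHull ℝ (Q ∪ {v, w}) := by
      rintro _ ⟨i, rfl⟩
      exact vertexSet_subset _ (hsv i)
    rw [IsMeek, affDim_basisPolytope s hrange, hP, affDim_affineSpan]
    have h1 : ⋃₀ avoidingComplex (convexHull ℝ (Q ∪ {v, w})) s ⊆ Q := by
      refine Set.sUnion_subset ?_
      rintro F ⟨hF, hav⟩
      have hav0 : v ∉ F := hav 0
      have hav1 : w ∉ F := hav 1
      obtain ⟨G, hG, hGQ, rfl | rfl | rfl⟩ := h.exists_face hQ hF (fun e => by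
        rw [e] at hav0
        exact hav0 (vertexSet_subset _ hvv))
      · exact subset_of_mem_faceComplex hG
      · exact absurd (left_mem_cone v G) hav0
      · exact absurd (left_mem_cone w G) hav1
    have h2 : vertexSet Q ⊆ ⋃₀ avoidingComplex (convexHull ℝ (Q ∪ {v, w})) s := by
      intro u hu
      refine ⟨{u}, ⟨h.base_face hQ hu (ne_base (by rw [affDim_singleton, hd]; norm_num)), ?_⟩, rfl⟩
      have huQ := vertexSet_subset Q hu
      intro i
      fin_cases i
      · exact fun e => h.left_notMem_base (Set.mem_of_eq_of_mem (Set.mem_singleton_iff.1 e) huQ)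
      · exact fun e => h.symm.left_notMem_base (Set.mem_of_eq_of_mem (Set.mem_singleton_iff.1 e) huQ)
    have h3 := affDim_mono h1
    have h4 := affDim_mono h2
    rw [hQ.affDim_vertexSet, hd] at h4
    push_cast
    omega

end AreApices

theorem bipyramid_mem_meekPolytopes (hQ : IsPolytope Q) (hd : affDim Q = 2)
    (h : IsBipyramidOver P Q) : P ∈ meekPolytopes V 3 1 := by
  obtain ⟨v, w, a, b, hvw, rfl⟩ := h.exists_areApices
  exact ⟨AreApices.isPolytope hQ, by rw [hvw.affDim_eq, hd]; rfl, hvw.exists_special hQ hd⟩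

theorem fVector_bipyramid (hQ : IsPolytope Q) (hd : affDim Q = 2) (h : IsBipyramidOver P Q) :
    fVector P = [1, (vertexSet Q).ncard + 2, 3 * (vertexSet Q).ncard,
      2 * (vertexSet Q).ncard, 1] := by
  obtain ⟨v, w, a, b, hvw, rfl⟩ := h.exists_areApices
  exact hvw.fVector_bipyramid hQ hd

/-- The polytopes of `meekPolytopes V 3 1` are bipyramids over polygons. -/
theorem exists_isBipyramidOver_of_mem_meekPolytopes (hP : P ∈ meekPolytopes V 3 1) :
    ∃ Q, IsPolytope Q ∧ affDim Q = 2 ∧ IsBipyramidOver P Q := by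
  obtain ⟨hP, hd, s, hs, hmeek⟩ := hP
  set W := vertexSet P \ Set.range s.points with hW
  have hWfin : W.Finite := hP.finite_vertexSet.subset Set.sdiff_subset
  have hWP : W ⊆ P := fun y hy => vertexSet_subset P hy.1
  have hvP : ∀ i, s.points i ∈ P := fun i => vertexSet_subset P (hs.1 i)
  have hrange : Set.range s.points ⊆ P := by
    rintro _ ⟨i, rfl⟩
    exact hvP i
  have hspl : vertexSet P ⊆ W ∪ Set.range s.points := fun y hy => by
    by_cases h : y ∈ Set.range s.points
    exacts [Or.inr h, Or.inl ⟨hy, h⟩]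
  -- Faces avoiding the edge are hulls of points of `W`, and each point of `W` is such a face;
  -- meekness thus gives `W` dimension `3 - 1`.
  have hWd : affDim W = 2 := by
    rw [IsMeek, affDim_basisPolytope s hrange, hd, affDim_affineSpan] at hmeek
    have h1 : ⋃₀ avoidingComplex P s ⊆ convexHull ℝ W := by
      refine Set.sUnion_subset ?_
      rintro F ⟨hF, hav⟩
      rw [hP.face_eq_convexHull hF]
      refine convexHull_mono fun y hy => ⟨hy.2, ?_⟩
      rintro ⟨i, rfl⟩
      exact hav i hy.1
    have h2 : W ⊆ ⋃₀ avoidingComplex P s := fun y hy =>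
      ⟨{y}, ⟨hy.1, fun i e => hy.2 ⟨i, e⟩⟩, rfl⟩
    have h3 := affDim_mono h1
    have h4 := affDim_mono h2
    rw [affDim_convexHull] at h3
    push_cast at hmeek
    omega
  have hWne : W.Nonempty := nonempty_of_affDim (n := 2) hWd
  obtain ⟨y₀, hy₀⟩ := hWne
  have hvalid : ∀ {L : StrongDual ℝ V} {M : ℝ}, (∀ y ∈ W, L y ≤ M) → (∀ i, L (s.points i) ≤ M) →
      ∀ y ∈ P, L y ≤ M := by
    intro L M h1 h2 y hy
    rw [← hP.convexHull_vertexSet] at hy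
    refine le_of_mem_convexHull (fun z hz => ?_) hy
    rcases hspl hz with hz | ⟨i, rfl⟩
    exacts [h1 z hz, h2 i]
  have hspanP : ∀ {x : V}, x ∈ P → x ∉ affineSpan ℝ W →
      affineSpan ℝ (insert x W) = affineSpan ℝ P := by
    intro x hx hxW
    refine affineSpan_eq_of_affDim_le (Set.insert_subset hx hWP) (Set.insert_nonempty x W) ?_
    rw [affDim_insert_of_notMem hxW, hWd, hd]
    norm_num
  -- If one end lay in the plane of `W`, the other would not. A functional with unique maximum at
  -- the first could then be changed off the plane to take the same value at the second, and would
  -- be maximal on the whole edge.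
  have hnotMem : ∀ i j, i ≠ j → s.points i ∉ affineSpan ℝ W := by
    intro i j hij hi
    have hall : ∀ k, k = i ∨ k = j := by
      intro k
      have := hij
      omega
    have hj : s.points j ∉ affineSpan ℝ W := by
      intro hj
      have h1 : vertexSet P ⊆ affineSpan ℝ W := by
        intro y hy
        rcases hspl hy with hy | ⟨k, rfl⟩
        · exact subset_affineSpan ℝ W hy
        · rcases hall k with rfl | rfl
          exacts [hi, hj]
      have := affDim_mono h1
      rw [hP.affDim_vertexSet, affDim_affineSpan, hd, hWd] at this
      norm_num at this
    obtain ⟨-, l, hl⟩ := exists_level_of_mem_vertexSet (hs.1 i)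
    obtain ⟨k, m, hk, hkj⟩ := exists_strongDual_of_notMem_affineSpan ⟨y₀, hy₀⟩ hj
      (l (s.points i) - l (s.points j))
    have hlt : ∀ y ∈ W, (l + k) y < l (s.points i) + m := fun y hy => by
      have := hl y (hWP hy) fun e => hy.2 ⟨i, e.symm⟩
      simpa [hk y (subset_affineSpan ℝ W hy)] using this
    have heq : ∀ x, (l + k) (s.points x) = l (s.points i) + m := by
      intro x
      rcases hall x with rfl | rfl
      · simp [hk _ hi]
      · simp only [add_apply, hkj]
        ring
    have := hs.eq_of_level hP (hvalid (fun y hy => (hlt y hy).le) fun x => (heq x).le) heq y₀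
      (hWP hy₀)
    exact (hlt y₀ hy₀).ne this
  have h0 := hnotMem 0 1 (by simp)
  have h1 := hnotMem 1 0 (by simp)
  obtain ⟨k, m, hk, hk0⟩ := exists_strongDual_of_notMem_affineSpan ⟨y₀, hy₀⟩ h0 1
  have hkW : ∀ y ∈ W, k y = m := fun y hy => hk y (subset_affineSpan ℝ W hy)
  -- Otherwise the plane of `W` supports `P`. A facet through `W` missing one end must contain the
  -- other, which lies off the plane, so it would be 3-dimensional.
  have hk1 : k (s.points 1) < m := by
    by_contra! hge
    have hval : ∀ y ∈ P, (-k) y ≤ -m := by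
      refine hvalid (fun y hy => by simp [hkW y hy]) fun i => ?_
      fin_cases i
      · simp [hk0]
      · simpa using hge
    obtain ⟨F, hF, h0F, hF'⟩ := hP.exists_facet_of_level_ne hval
      ⟨y₀, hWP hy₀, by simp [hkW y₀ hy₀]⟩ (hvP 0) (by simp [hk0])
    have h1F := hs.mem_of_ne hF h0F (j := 1) (by simp)
    have hsub : insert (s.points 1) W ⊆ F :=
      Set.insert_subset h1F fun y hy => hF' y (hWP hy) (by simp [hkW y hy])
    have h2 := affDim_mono hsub
    rw [affDim_insert_of_notMem h1, hWd, hF.2, hd] at h2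
    norm_num at h2
  -- The heights `k` of the ends are `m + 1` and `k (s.points 1)`; this weight puts `p` at height
  -- `m`, in the plane of `W`.
  set b := 1 / (m + 1 - k (s.points 1)) with hb
  have hden : 0 < m + 1 - k (s.points 1) := by linarith
  have hb0 : 0 < b := one_div_pos.2 hden
  have hb1 : b < 1 := (div_lt_one hden).2 (by linarith)
  have hbeq : b * (m + 1 - k (s.points 1)) = 1 := div_mul_cancel₀ _ hden.ne'
  set p := (1 - b) • s.points 0 + b • s.points 1 with hp
  have hkp : k p = m := by
    simp only [hp, map_add, map_smul, smul_eq_mul, hk0]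
    linarith
  have hpP : p ∈ P := hP.convex (hvP 0) (hvP 1) (by linarith) hb0.le (by ring)
  have hpA : p ∈ affineSpan ℝ W := by
    have h2 : p - y₀ ∈ vectorSpan ℝ (insert (s.points 0) W) := by
      refine sub_mem_vectorSpan ?_ (subset_affineSpan ℝ _ (Set.mem_insert_of_mem _ hy₀))
      rw [hspanP (hvP 0) h0]
      exact subset_affineSpan ℝ P hpP
    rw [vectorSpan_insert_eq_sup hy₀] at h2
    obtain ⟨d, hd', e, he, hde⟩ := Submodule.mem_sup.1 h2
    obtain ⟨r, rfl⟩ := Submodule.mem_span_singleton.1 he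
    have h3 := congrArg k hde
    simp [map_eq_zero_of_mem_vectorSpan hkW hd', hk0, hkp, hkW y₀ hy₀] at h3
    rw [h3, zero_smul, add_zero] at hde
    have := add_mem_affineSpan (subset_affineSpan ℝ W hy₀) hd'
    rwa [hde, add_sub_cancel] at this
  have hQ : IsPolytope (convexHull ℝ W) := isPolytope_convexHull hWfin
  refine ⟨convexHull ℝ W, hQ, by rw [affDim_convexHull, hWd], s.points 0, s.points 1,
    by rwa [affineSpan_convexHull], by rwa [affineSpan_convexHull], ⟨p, ?_, ?_⟩, ?_⟩
  · exact ⟨1 - b, b, by linarith, hb0, by ring, rfl⟩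
  · by_contra hpi
    obtain ⟨l, M, hl, ⟨y, hy, hyM⟩, hlp⟩ := hQ.exists_le_of_notMem_intrinsicInterior
      ⟨y₀, subset_convexHull ℝ W hy₀⟩ (by rwa [affineSpan_convexHull]) hpi
    -- Adding `c • k` changes `l` by a constant on the plane of `W` and makes it constant along the
    -- edge. Since `p` does not satisfy the facet inequality strictly, the result is maximal on the
    -- whole edge.
    set c := l p - l (s.points 0) with hc
    have hL0 : (l + c • k) (s.points 0) = (l + c • k) p := by
      simp [hk0, hkp, hc]; ring
    have hL1 : (l + c • k) (s.points 1) = (l + c • k) p := by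
      have h2 : (l + c • k) p = (1 - b) * (l + c • k) (s.points 0) + b * (l + c • k) (s.points 1) := by
        rw [hp, map_add, map_smul, map_smul, smul_eq_mul, smul_eq_mul]
      rw [hL0] at h2
      exact mul_left_cancel₀ hb0.ne' (by linarith)
    have hLs : ∀ i, (l + c • k) (s.points i) = (l + c • k) p := by
      intro i
      fin_cases i
      exacts [hL0, hL1]
    have hkQ : ∀ z ∈ convexHull ℝ W, k z = m := fun z hz => hk z (convexHull_subset_affineSpan W hz)
    have hLp : (l + c • k) p = l p + c * m := by simp [hkp]
    have hLz : ∀ z ∈ convexHull ℝ W, (l + c • k) z = l z + c * m := fun z hz => by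
      simp [hkQ z hz]
    have hall := hs.eq_of_level hP (hvalid (fun z hz => by
      have hz' := subset_convexHull ℝ W hz
      rw [hLz z hz', hLp]
      linarith [hl z hz']) fun i => (hLs i).le) hLs y (convexHull_min hWP hP.convex hy)
    rw [hLz y hy, hLp] at hall
    linarith
  · rw [convexHull_convexHull_union_left]
    conv_lhs => rw [← hP.convexHull_vertexSet]
    congr 1
    have hr : Set.range s.points = {s.points 0, s.points 1} := by
      ext y
      simp [Fin.exists_fin_two, eq_comm]
    rw [← hr]
    refine hspl.antisymm (Set.union_subset Set.sdiff_subset ?_)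
    rintro _ ⟨i, rfl⟩
    exact hs.1 i

end Bipyramid

/-! ### Bipyramids over polygons with any number of vertices -/

section Examples

/-- The `i`-th vertex of a polygon inscribed in a parabola in the plane of `e₁`, `e₂`. -/
noncomputable def parabolaPoint {V : Type*} [AddCommGroup V] [Module ℝ V] (e₁ e₂ : V) (i : ℕ) : V :=
  (i : ℝ) • e₁ + ((i : ℝ) ^ 2) • e₂

variable {V : Type*} [NormedAddCommGroup V] [NormedSpace ℝ V] [FiniteDimensional ℝ V]

theorem exists_polygon {e₁ e₂ : V} {x₁ x₂ : StrongDual ℝ V} (h₁₁ : x₁ e₁ = 1) (h₁₂ : x₁ e₂ = 0)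
    (h₂₁ : x₂ e₁ = 0) (h₂₂ : x₂ e₂ = 1) {k : ℕ} (hk : 3 ≤ k) :
    ∃ Q : Set V, IsPolytope Q ∧ affDim Q = 2 ∧ (vertexSet Q).ncard = k ∧
      Q ⊆ Submodule.span ℝ {e₁, e₂} := by
  classical
  set u := parabolaPoint e₁ e₂ with hu
  have hx₁ : ∀ i, x₁ (u i) = i := fun i => by simp [hu, parabolaPoint, h₁₁, h₁₂]
  have hx₂ : ∀ i, x₂ (u i) = (i : ℝ) ^ 2 := fun i => by simp [hu, parabolaPoint, h₂₁, h₂₂]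
  have hinj : Function.Injective u := fun i j hij => by
    have := congrArg x₁ hij
    rw [hx₁, hx₁] at this
    exact_mod_cast this
  have hspan : ∀ i, u i ∈ Submodule.span ℝ {e₁, e₂} := fun i =>
    Submodule.mem_span_pair.2 ⟨_, _, rfl⟩
  set S : Finset V := (Finset.range k).image u with hS
  have hSsub : (S : Set V) ⊆ Submodule.span ℝ {e₁, e₂} := by
    intro y hy
    obtain ⟨i, -, rfl⟩ := Finset.mem_image.1 hy
    exact hspan i
  have hmem : ∀ i, i < k → u i ∈ S := fun i hi =>
    Finset.mem_image_of_mem u (Finset.mem_range.2 hi)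
  have hverts : vertexSet (convexHull ℝ (S : Set V)) = S := by
    refine (vertexSet_convexHull_subset _).antisymm ?_
    intro y hy
    obtain ⟨i, hi, rfl⟩ := Finset.mem_image.1 hy
    -- The tangent to the parabola at its `i`-th point: completing the square shows that the maximum
    -- is attained there only.
    set l : StrongDual ℝ V := (2 * (i : ℝ)) • x₁ - x₂ with hl
    have hli : ∀ j, l (u j) = (i : ℝ) ^ 2 - ((j : ℝ) - i) ^ 2 := fun j => by
      simp [hl, hx₁, hx₂]; ring
    have hval : ∀ z ∈ (S : Set V), l z ≤ (i : ℝ) ^ 2 := by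
      intro z hz
      obtain ⟨j, -, rfl⟩ := Finset.mem_image.1 hz
      rw [hli]
      linarith [sq_nonneg ((j : ℝ) - i)]
    have := level_mem_faceComplex (fun z hz => le_of_mem_convexHull hval hz)
    rw [convexHull_inter_level hval] at this
    have e : {z | z ∈ (S : Set V) ∧ l z = (i : ℝ) ^ 2} = {u i} := by
      ext z
      constructor
      · rintro ⟨hz, hlz⟩
        obtain ⟨j, -, rfl⟩ := Finset.mem_image.1 hz
        rw [hli] at hlz
        have h0 : (j : ℝ) - i = 0 := pow_eq_zero_iff (two_ne_zero) |>.1 (by linarith)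
        have : j = i := by exact_mod_cast sub_eq_zero.1 h0
        rw [this]; rfl
      · rintro rfl
        exact ⟨hy, by rw [hli]; ring⟩
    rw [e, convexHull_singleton] at this
    exact this
  refine ⟨convexHull ℝ (S : Set V), ⟨S, rfl⟩, ?_, ?_, ?_⟩
  · rw [affDim_convexHull]
    apply le_antisymm
    · rw [affDim_of_nonempty ⟨u 0, hmem 0 (by omega)⟩]
      have h1 : vectorSpan ℝ (S : Set V) ≤ Submodule.span ℝ {e₁, e₂} := by
        refine Submodule.span_le.2 ?_
        rintro _ ⟨y, hy, z, hz, rfl⟩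
        exact Submodule.sub_mem _ (hSsub hy) (hSsub hz)
      have h2 := Submodule.finrank_mono h1
      have h3 := finrank_span_finset_le_card (R := ℝ) ({e₁, e₂} : Finset V)
      have h4 := Finset.card_le_two (a := e₁) (b := e₂)
      rw [Finset.coe_pair] at h3
      have h5 := (h2.trans h3).trans h4
      exact_mod_cast h5
    · have h1 : u 1 ∉ affineSpan ℝ ({u 0} : Set V) := by
        rw [AffineSubspace.mem_affineSpan_singleton]
        exact fun e => by simpa using hinj e
      have h2 : u 2 ∉ affineSpan ℝ ({u 1, u 0} : Set V) := by
        intro h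
        -- The functional `x₁ - x₂` vanishes at the points `0` and `1` of the parabola and equals
        -- `-2` at the point `2`.
        have := map_eq_of_mem_affineSpan (l := x₁ - x₂) (M := 0) (by
          rintro _ (rfl | rfl) <;> simp [hx₁, hx₂]) h
        simp [hx₁, hx₂] at this
        norm_num at this
      have h3 := affDim_mono (show ({u 2, u 1, u 0} : Set V) ⊆ S by
        rintro _ (rfl | rfl | rfl)
        exacts [hmem 2 (by omega), hmem 1 (by omega), hmem 0 (by omega)])
      rw [affDim_insert_of_notMem h2, affDim_insert_of_notMem h1, affDim_singleton] at h3
      exact h3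
  · rw [hverts, Set.ncard_coe_finset, hS, Finset.card_image_of_injective _ hinj,
      Finset.card_range]
  · exact convexHull_min hSsub (Submodule.convex _)

theorem exists_bipyramid {e₁ e₂ e₃ : V} {x₁ x₂ x₃ : StrongDual ℝ V} (h₁₁ : x₁ e₁ = 1)
    (h₁₂ : x₁ e₂ = 0) (h₂₁ : x₂ e₁ = 0) (h₂₂ : x₂ e₂ = 1) (h₃₁ : x₃ e₁ = 0) (h₃₂ : x₃ e₂ = 0)
    (h₃₃ : x₃ e₃ = 1) {k : ℕ} (hk : 3 ≤ k) :
    ∃ P ∈ meekPolytopes V 3 1, fVector P = [1, k + 2, 3 * k, 2 * k, 1] := by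
  obtain ⟨Q, hQ, hd, hcard, hsub⟩ := exists_polygon h₁₁ h₁₂ h₂₁ h₂₂ hk
  obtain ⟨p, hp⟩ := (nonempty_of_affDim (n := 2) hd).intrinsicInterior hQ.convex
  have hx₃ : ∀ y ∈ Q, x₃ y = 0 := fun y hy => by
    obtain ⟨a, b, rfl⟩ := Submodule.mem_span_pair.1 (hsub hy)
    simp [h₃₁, h₃₂]
  have hp0 := hx₃ p (intrinsicInterior_subset hp)
  have hbip : IsBipyramidOver (convexHull ℝ (Q ∪ {p + e₃, p - e₃})) Q := by
    refine ⟨p + e₃, p - e₃, fun h => ?_, fun h => ?_, ⟨p, ?_, hp⟩, rfl⟩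
    · have := map_eq_of_mem_affineSpan hx₃ h
      simp [hp0, h₃₃] at this
    · have := map_eq_of_mem_affineSpan hx₃ h
      simp [hp0, h₃₃] at this
    · refine ⟨1 / 2, 1 / 2, by norm_num, by norm_num, by norm_num, ?_⟩
      module
  exact ⟨_, bipyramid_mem_meekPolytopes hQ hd hbip, hcard ▸ fVector_bipyramid hQ hd hbip⟩

end Examples

/-! ### The classification -/

theorem mainTheorem10 (q : ℕ) :
    (specialPolytopes (EuclideanSpace ℝ (Fin q)) 2 1 =
        {P | IsPolytope P ∧ fVector P = [1, 4, 4, 1]} ∧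
      meekPolytopes (EuclideanSpace ℝ (Fin q)) 2 1 =
        {P | IsPolytope P ∧ fVector P = [1, 4, 4, 1]}) ∧
    (specialPolytopes (EuclideanSpace ℝ (Fin q)) 3 2 =
        {P | IsPolytope P ∧ (fVector P = [1, 5, 9, 6, 1] ∨ fVector P = [1, 5, 8, 5, 1])} ∧
      meekPolytopes (EuclideanSpace ℝ (Fin q)) 3 2 =
        {P | IsPolytope P ∧ (fVector P = [1, 5, 9, 6, 1] ∨ fVector P = [1, 5, 8, 5, 1])}) ∧
    (meekPolytopes (EuclideanSpace ℝ (Fin q)) 3 1 =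
        {P | ∃ Q, IsPolytope Q ∧ affDim Q = 2 ∧ IsBipyramidOver P Q} ∧
      (∀ P Q : Set (EuclideanSpace ℝ (Fin q)),
        IsPolytope Q → affDim Q = 2 → IsBipyramidOver P Q →
          ∃ k : ℕ, 3 ≤ k ∧ fVector Q = [1, k, k, 1] ∧
            fVector P = [1, k + 2, 3 * k, 2 * k, 1]) ∧
      (3 ≤ q → ∀ k : ℕ, 3 ≤ k →
        ∃ P ∈ meekPolytopes (EuclideanSpace ℝ (Fin q)) 3 1,
          fVector P = [1, k + 2, 3 * k, 2 * k, 1])) := by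
  refine ⟨⟨?_, ?_⟩, ⟨?_, ?_⟩, ?_, ?_, ?_⟩
  · exact specialPolytopes_two_one_subset.antisymm
      (subset_meekPolytopes_two_one.trans (meekPolytopes_subset 2 1))
  · exact ((meekPolytopes_subset 2 1).trans specialPolytopes_two_one_subset).antisymm
      subset_meekPolytopes_two_one
  · exact specialPolytopes_three_two_subset.antisymm
      (subset_meekPolytopes_three_two.trans (meekPolytopes_subset 3 2))
  · exact ((meekPolytopes_subset 3 2).trans specialPolytopes_three_two_subset).antisymm
      subset_meekPolytopes_three_two
  · ext P
    exact ⟨exists_isBipyramidOver_of_mem_meekPolytopes,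
      fun ⟨Q, hQ, hd, h⟩ => bipyramid_mem_meekPolytopes hQ hd h⟩
  · intro P Q hQ hd h
    exact ⟨(vertexSet Q).ncard, (hQ.fVector_polygon hd).1, (hQ.fVector_polygon hd).2,
      fVector_bipyramid hQ hd h⟩
  · intro hq k hk
    let i₁ : Fin q := ⟨0, by omega⟩
    let i₂ : Fin q := ⟨1, by omega⟩
    let i₃ : Fin q := ⟨2, by omega⟩
    exact exists_bipyramid (e₁ := EuclideanSpace.single i₁ 1) (e₂ := EuclideanSpace.single i₂ 1)
      (e₃ := EuclideanSpace.single i₃ 1) (x₁ := EuclideanSpace.proj i₁)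
      (x₂ := EuclideanSpace.proj i₂) (x₃ := EuclideanSpace.proj i₃) (by simp)
      (by simp [i₁, i₂]) (by simp [i₁, i₂]) (by simp) (by simp [i₁, i₃]) (by simp [i₂, i₃])
      (by simp) hk
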